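/- **Setting.** For each latent dimension $d\ge 1$, fix (everything below may depend on $d$) an observation $x$, integers $a,b\ge0$ with $a+b\ge1$, open sets $\Theta\subseteq\mathbb R^a$, $\Phi\subseteq\mathbb R^b$, a $\sigma$-finite measure $\nu$ on $\mathbb R^d$, nonnegative densities $p_\theta(x,z)$ and $q_\phi(z|x)$ with respect to $\nu(\mathrm dz)$, a noise law $q$ and a map $f$. Put $p_\theta(x)=\int p_\theta(x,z)\,\nu(\mathrm dz)$, $p_\theta(z|x)=p_\theta(x,z)/p_\theta(x)$ and $\ell_d(\theta;x)=\log p_\theta(x)$. Assume that for all $\theta\in\Theta$, $\phi\in\Phi$: $p_\theta(x)<\infty$, $\int q_\phi(z|x)\,\nu(\mathrm dz)=1$, and $p_\theta(z|x),q_\phi(z|x)>0$ for $\nu$-a.e. $z$; that $\theta\mapsto p_\theta(x)$, $(z,\theta)\mapsto p_\theta(z|x)$ and $(z,\phi)\mapsto q_\phi(z|x)$ are differentiable on $\Theta$, $\mathbb R^d\times\Theta$ and $\mathbb R^d\times\Phi$; that for $\varepsilon\sim q$ one has $f(\varepsilon,\phi;x)\sim q_\phi(\cdot|x)$ for all $\phi\in\Phi$;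 and that almost surely $\phi\mapsto f(\varepsilon,\phi;x)$ is differentiable on $\Phi$ and $p_\theta(x,f(\varepsilon,\phi';x))>0$, $q_\phi(f(\varepsilon,\phi';x)|x)>0$ for all $(\theta,\phi,\phi')\in\Theta\times\Phi^2$. Write $$\tilde w_{\theta,\phi,\phi'}(\varepsilon)=\frac{p_\theta(x,f(\varepsilon,\phi';x))}{q_\phi(f(\varepsilon,\phi';x)|x)},\qquad B_d=\sqrt{\mathbb V_{\varepsilon\sim q}\big(\log \tilde w_{\theta,\phi,\phi}(\varepsilon)\big)} .$$ Let $\psi$ be one component of $(\theta,\phi)\in\mathbb R^{a+b}$. For $\alpha\in[0,1)$, $N\ge1$ and $\varepsilon_1,\dots,\varepsilon_N$ i.i.d. from $q$, the reparameterized gradient estimator is $$\mathrm{REP}_{1,N,d}=\sum_{j=1}^N\frac{\tilde w_{\theta,\phi,\phi}(\varepsilon_j)^{1-\alpha}}{\sum_{l=1}^N\tilde w_{\theta,\phi,\phi}(\varepsilon_l)^{1-\alpha}}\;\partial_\psi\big[\log\tilde w_{\theta,\phi,\phi}(\varepsilon_j)\big],$$ where $\partial_\psi$ differentiates with respect to all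 occurrences of $\psi$ in $\log\tilde w_{\theta,\phi,\phi}$. Let $\mathrm{SNR}[X]=|\mathbb E X|/\sqrt{\mathbb V(X)}$. A $\psi$-neighborhood of $(\theta,\phi)$ is a set containing, for some $r>0$, all vectors obtained by moving only the component $\psi$ of $(\theta,\phi)$ by less than $r$. **Theorem.** Assume that, for every $d$, 1. for $\varepsilon\sim q$, $(\log\tilde w_{\theta,\phi,\phi'}(\varepsilon))_{(\theta,\phi,\phi')\in\Theta\times\Phi^2}$ is a Gaussian random field; 2. every $(\theta,\phi)\in\Theta\times\Phi$ has a $\psi$-neighborhood $\mathcal V\subseteq\Theta\times\Phi$ such that $$\mathbb E_{\varepsilon\sim q}\Big(\sup_{(\theta',\phi')\in\mathcal V}\big(\partial_{\psi'}\log\tilde w_{\theta',\phi',\phi'}(\varepsilon)\big)^2\Big)<\infty,\qquad \mathbb E_{\varepsilon\sim q}\Big(\sup_{(\theta',\phi')\in\mathcal V}\big(\log\tilde w_{\theta',\phi',\phi'}(\varepsilon)\big)^2\Big)<\infty .$$ For each $d$ fix a point $(\theta,\phi)\in\Theta\times\Phi$ at which the quantities below are evaluated, and let $\alpha\in[0,1)$.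 Let $N,d\to\infty$ jointly (for instance along a sequence $(N_n,d_n)$ with $N_n\to\infty$ and $d_n\to\infty$) in such a way that, eventually, $\mathbb V(\mathrm{REP}_{1,1,d})>0$, and $$\log N=o(B_d^2),\qquad \mathrm{SNR}\big[\mathrm{REP}_{1,1,d}-\partial_\psi\ell_d(\theta;x)\big]\;\frac{\sqrt{\log N}}{B_d}\longrightarrow0 .$$ Then, eventually, $\mathrm{REP}_{1,1,d}$ and $\mathrm{REP}_{1,N,d}$ are square integrable with positive variance (so that their SNRs are well defined), and $$\mathrm{SNR}[\mathrm{REP}_{1,N,d}]=\mathrm{SNR}[\mathrm{REP}_{1,1,d}]\,(1+o(1))+o(1).$$ -/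

import Mathlib

open MeasureTheory ProbabilityTheory Filter Topology Asymptotics Set

noncomputable section

/-- The signal-to-noise ratio `|𝔼 X| / √(𝕍 X)` of a real random variable `X`. -/
def snr {Ω : Type*} [MeasurableSpace Ω] (X : Ω → ℝ) (P : Measure Ω) : ℝ :=
  |∫ ω, X ω ∂P| / √(Var[X; P])

/-- The parameters `(θ, φ) ∈ ℝᵃ × ℝᵇ`. -/
abbrev Param (a b : ℕ) : Type := (Fin a → ℝ) × (Fin b → ℝ)

/-- The component of `(θ, φ)` designated by `ψ`: `inl k` stands for `θ_k`, `inr k` for `φ_k`. -/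
def Param.comp {a b : ℕ} (ψ : Fin a ⊕ Fin b) (p : Param a b) : ℝ :=
  Sum.elim p.1 p.2 ψ

/-- The vector obtained from `(θ, φ)` by replacing its component `ψ` by the number `t`. -/
def Param.replace {a b : ℕ} (ψ : Fin a ⊕ Fin b) (t : ℝ) (p : Param a b) : Param a b :=
  match ψ with
  | Sum.inl k => (Function.update p.1 k t, p.2)
  | Sum.inr k => (p.1, Function.update p.2 k t)

/-- The partial derivative `∂_ψ g` of `g` at `(θ, φ)`. -/
def Param.pderiv {a b : ℕ} (ψ : Fin a ⊕ Fin b) (g : Param a b → ℝ) (p : Param a b) : ℝ :=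
  deriv (fun t : ℝ => g (p.replace ψ t)) (p.comp ψ)

/-- `V` is a `ψ`-neighborhood of `(θ, φ)`: for some `r > 0`, it contains every vector obtained by
moving the component `ψ` of `(θ, φ)` by less than `r`. -/
def Param.IsNbhd {a b : ℕ} (ψ : Fin a ⊕ Fin b) (V : Set (Param a b)) (p : Param a b) : Prop :=
  ∃ r : ℝ, 0 < r ∧ ∀ t ∈ Ioo (p.comp ψ - r) (p.comp ψ + r), p.replace ψ t ∈ V

/-- The data of the variational problem with latent space `ℝᵈ` and parameters in `ℝᵃ × ℝᵇ`, at a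
fixed observation `x` (which is therefore not written). Only the topology, the Borel sets and the
differentiable structure of `ℝⁿ = Fin n → ℝ` are used. -/
structure LatentModel (d a b : ℕ) (E : Type*) [MeasurableSpace E] where
  /-- the set of model parameters `θ` -/
  Θ : Set (Fin a → ℝ)
  /-- the set of variational parameters `φ` -/
  Φ : Set (Fin b → ℝ)
  /-- the dominating measure on the latent space -/
  ν : Measure (Fin d → ℝ)
  /-- `joint θ z` is `p_θ(x, z)` -/
  joint : (Fin a → ℝ) → (Fin d → ℝ) → ℝ
  /-- `q φ z` is `q_φ(z | x)` -/
  q : (Fin b → ℝ) → (Fin d → ℝ) → ℝ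
  /-- the law of the noise `ε` of the reparameterization -/
  noise : Measure E
  /-- `f ε φ` is `f(ε, φ; x)` -/
  f : E → (Fin b → ℝ) → (Fin d → ℝ)

namespace LatentModel

variable {d a b : ℕ} {E : Type*} [MeasurableSpace E] (M : LatentModel d a b E)

/-- The marginal likelihood `p_θ(x) = ∫ p_θ(x, z) ν(dz)`. -/
def evidence (θ : Fin a → ℝ) : ℝ := ∫ z, M.joint θ z ∂M.ν

/-- The posterior density `p_θ(z | x) = p_θ(x, z) / p_θ(x)`. -/
def posterior (θ : Fin a → ℝ) (z : Fin d → ℝ) : ℝ := M.joint θ z / M.evidence θ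

/-- The marginal log likelihood `ℓ_d(θ; x) = log p_θ(x)`. -/
def logLik (θ : Fin a → ℝ) : ℝ := Real.log (M.evidence θ)

/-- The importance weight `w_{θ,φ}(z; x) = p_θ(x, z) / q_φ(z | x)`. -/
def weight (θ : Fin a → ℝ) (φ : Fin b → ℝ) (z : Fin d → ℝ) : ℝ := M.joint θ z / M.q φ z

/-- The reparameterized weight `w_{θ,φ}(f(ε, φ'; x); x)`. -/
def repWeight (θ : Fin a → ℝ) (φ φ' : Fin b → ℝ) (ε : E) : ℝ := M.weight θ φ (M.f ε φ')

/-- The log-weight `log w_{θ,φ}(f(ε, φ; x); x)`, as a function of `(θ, φ)` for given `ε`. -/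
def logWeight (ε : E) (p : Param a b) : ℝ := Real.log (M.repWeight p.1 p.2 p.2 ε)

/-- `B_d(θ, φ, φ'; x)`: the standard deviation of `log w_{θ,φ}(f(ε, φ'; x); x)`. -/
def B (θ : Fin a → ℝ) (φ φ' : Fin b → ℝ) : ℝ :=
  √(Var[fun ε => Real.log (M.repWeight θ φ φ' ε); M.noise])

/-- The law of an i.i.d. sample `(ε_1, …, ε_N)` of the noise. -/
def sampleLaw (N : ℕ) : Measure (Fin N → E) := Measure.pi fun _ => M.noise

/-- The reparameterized gradient estimator of the VR-IWAE bound with respect to `ψ` at `(θ, φ)`,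
built from one batch `ε_1, …, ε_N` of noise variables:
`∑_j (w_j^{1-α} / ∑_l w_l^{1-α}) ∂_ψ log w_{θ,φ}(f(ε_j, φ; x); x)`,
with `w_j = w_{θ,φ}(f(ε_j, φ; x); x)`. -/
def gradREP (α : ℝ) (ψ : Fin a ⊕ Fin b) (N : ℕ) (p : Param a b) (ε : Fin N → E) : ℝ :=
  ∑ j, M.repWeight p.1 p.2 p.2 (ε j) ^ (1 - α)
      / (∑ l, M.repWeight p.1 p.2 p.2 (ε l) ^ (1 - α))
    * Param.pderiv ψ (M.logWeight (ε j)) p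

/-- The standing assumptions on the model, the variational family and the reparameterization. -/
structure Standing : Prop where
  isOpen_Θ : IsOpen M.Θ
  isOpen_Φ : IsOpen M.Φ
  sigmaFinite_ν : SigmaFinite M.ν
  isProbabilityMeasure_noise : IsProbabilityMeasure M.noise
  joint_nonneg : ∀ θ ∈ M.Θ, ∀ z, 0 ≤ M.joint θ z
  q_nonneg : ∀ φ ∈ M.Φ, ∀ z, 0 ≤ M.q φ z
  integrable_joint : ∀ θ ∈ M.Θ, Integrable (M.joint θ) M.ν
  integral_q : ∀ φ ∈ M.Φ, ∫ z, M.q φ z ∂M.ν = 1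
  posterior_pos : ∀ θ ∈ M.Θ, ∀ᵐ z ∂M.ν, 0 < M.posterior θ z
  q_pos : ∀ φ ∈ M.Φ, ∀ᵐ z ∂M.ν, 0 < M.q φ z
  differentiable_evidence : DifferentiableOn ℝ M.evidence M.Θ
  differentiable_posterior :
    DifferentiableOn ℝ (fun y : (Fin d → ℝ) × (Fin a → ℝ) => M.posterior y.2 y.1) (univ ×ˢ M.Θ)
  differentiable_q :
    DifferentiableOn ℝ (fun y : (Fin d → ℝ) × (Fin b → ℝ) => M.q y.2 y.1) (univ ×ˢ M.Φ)
  /-- `f(ε, φ; x) ∼ q_φ(· | x)` -/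
  hasLaw_f : ∀ φ ∈ M.Φ,
    HasLaw (fun ε => M.f ε φ) (M.ν.withDensity fun z => ENNReal.ofReal (M.q φ z)) M.noise
  differentiable_f : ∀ᵐ ε ∂M.noise, DifferentiableOn ℝ (M.f ε) M.Φ
  /-- almost surely, the log-weights are well defined as real numbers at all parameters -/
  pos : ∀ᵐ ε ∂M.noise, ∀ θ ∈ M.Θ, ∀ φ ∈ M.Φ, ∀ φ' ∈ M.Φ,
    0 < M.joint θ (M.f ε φ') ∧ 0 < M.q φ (M.f ε φ')

/-- For `ε ∼ q`, the log-weights `log w_{θ,φ}(f(ε, φ'; x); x)`, `(θ, φ, φ') ∈ Θ × Φ²`, form a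
Gaussian random field. -/
def IsGaussianField : Prop :=
  IsGaussianProcess
    (fun (s : ↥(M.Θ ×ˢ (M.Φ ×ˢ M.Φ))) (ε : E) =>
      Real.log (M.repWeight s.1.1 s.1.2.1 s.1.2.2 ε))
    M.noise

/-- `𝔼 (sup_{p ∈ V} (g ε p)²) < ∞` for `ε ∼ q`. Since the supremum need not be measurable, the
condition is that it has an integrable majorant; for a measurable supremum this is the same. -/
def SupSqIntegrable (g : E → Param a b → ℝ) (V : Set (Param a b)) : Prop :=
  ∃ G : E → ℝ, Integrable G M.noise ∧ ∀ᵐ ε ∂M.noise, ∀ p ∈ V, g ε p ^ 2 ≤ G ε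

/-- The domination conditions: every `(θ, φ) ∈ Θ × Φ` has a `ψ`-neighborhood in `Θ × Φ` on which
the log-weight and its derivative with respect to `ψ` have square integrable suprema. -/
def Dominated (ψ : Fin a ⊕ Fin b) : Prop :=
  ∀ p ∈ M.Θ ×ˢ M.Φ, ∃ V ⊆ M.Θ ×ˢ M.Φ, Param.IsNbhd ψ V p ∧
    M.SupSqIntegrable (fun ε => Param.pderiv ψ (M.logWeight ε)) V ∧
    M.SupSqIntegrable M.logWeight V

end LatentModel

end

/-! Write X for the log-weight and Y for its ψ-derivative at the fixed point. Difference quotients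
of the field are Gaussian and dominated in L², so (X, Y) is jointly Gaussian
(`hasGaussianLaw_prodMk_deriv`). Regress Y on the standardized G = (X - 𝔼X)/B: Y = 𝔼Y + kG + R with
k = cov(X, Y)/B and R independent of G. The normalized weights of the estimator are the softmax
weights λ of the G_j at inverse temperature β = (1-α)B, hence independent of the residuals. With V =
𝕍Y, S = ∑ λ_j G_j and Q = 𝔼 ∑ λ_j², this yields mean 𝔼Y + k 𝔼S and variance k² 𝕍S + (V - k²) Q
(`selfNormalized_moments`).

Two facts about S suffice. Gaussian integration by parts gives 𝔼S = β(1 - Q)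
(`integral_softmaxMean`), and 𝔼S² ≤ C(1 + log N) uniformly in β
(`exists_integral_sq_softmaxMean_le`). So 1 - Q is at most of order √(log N)/B, which tends to 0: a
single sample carries almost all the weight.

It remains to make the k-terms negligible. As 𝔼 exp X = p_θ(x), the Gaussian moment generating
function gives ℓ = 𝔼X + 𝕍X/2, whose derivative is 𝔼Y + cov(X, Y) (`Standing.hasGaussianLaw_pderiv`).
Hence the one-sample estimator minus the score has SNR |cov(X, Y)|/√V, and the last hypothesis says
exactly that k² log N / V → 0. The mean is then 𝔼Y + o(√V) and the variance V(1 + o(1))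
(`exists_snr_asymptotics`). -/

noncomputable section

/-! ### Softmax weights and deterministic bounds -/

/-- The softmax weights at inverse temperature `β`. -/
def softmax {ι : Type*} [Fintype ι] (β : ℝ) (g : ι → ℝ) (j : ι) : ℝ :=
  Real.exp (β * g j) / ∑ l, Real.exp (β * g l)

/-- The softmax average of the coordinates. -/
def softmaxMean {ι : Type*} [Fintype ι] (β : ℝ) (g : ι → ℝ) : ℝ :=
  ∑ j, softmax β g j * g j

section Softmax

variable {ι : Type*} [Fintype ι] (β : ℝ)

lemma softmax_nonneg (g : ι → ℝ) (j : ι) : 0 ≤ softmax β g j :=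
  div_nonneg (Real.exp_pos _).le (Finset.sum_nonneg fun _ _ => (Real.exp_pos _).le)

lemma sum_exp_pos [Nonempty ι] (g : ι → ℝ) : 0 < ∑ l, Real.exp (β * g l) :=
  Finset.sum_pos (fun _ _ => Real.exp_pos _) Finset.univ_nonempty

lemma sum_softmax [Nonempty ι] (g : ι → ℝ) : ∑ j, softmax β g j = 1 := by
  unfold softmax
  rw [← Finset.sum_div, div_self (sum_exp_pos β g).ne']

lemma softmax_le_one (g : ι → ℝ) (j : ι) : softmax β g j ≤ 1 :=
  div_le_one_of_le₀ (Finset.single_le_sum (f := fun l => Real.exp (β * g l))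
    (fun _ _ => (Real.exp_pos _).le) (Finset.mem_univ j))
    (Finset.sum_nonneg fun _ _ => (Real.exp_pos _).le)

lemma abs_softmax_le_one (g : ι → ℝ) (j : ι) : |softmax β g j| ≤ 1 := by
  rw [abs_of_nonneg (softmax_nonneg β g j)]
  exact softmax_le_one β g j

@[fun_prop]
lemma measurable_softmax (j : ι) : Measurable fun g : ι → ℝ => softmax β g j := by
  unfold softmax
  fun_prop

/-- As a function of its own coordinate the weight is e^{βt}/(e^{βt} + c) with c fixed. This is the
derivative needed for integration by parts in coordinate j. -/
lemma hasDerivAt_softmax_update [Nonempty ι] [DecidableEq ι] (g : ι → ℝ) (j : ι) :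
    HasDerivAt (fun t => softmax β (Function.update g j t) j)
      (β * (softmax β g j - softmax β g j ^ 2)) (g j) := by
  have hnum : HasDerivAt (fun t => Real.exp (β * t)) (Real.exp (β * g j) * β) (g j) := by
    simpa using ((hasDerivAt_id (g j)).const_mul β).exp
  have hS := sum_exp_pos β g
  have hden : ∀ t, ∑ l, Real.exp (β * Function.update g j t l)
      = Real.exp (β * t) + (∑ l, Real.exp (β * g l) - Real.exp (β * g j)) := by
    intro t
    rw [← Finset.add_sum_erase _ _ (Finset.mem_univ j),
      ← Finset.add_sum_erase _ (fun l => Real.exp (β * g l)) (Finset.mem_univ j)]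
    simp only [Function.update_self, add_sub_cancel_left]
    congr 1
    refine Finset.sum_congr rfl fun l hl => ?_
    rw [Function.update_of_ne (Finset.ne_of_mem_erase hl)]
  have key : (fun t => softmax β (Function.update g j t) j) = fun t =>
      Real.exp (β * t) / (Real.exp (β * t)
        + (∑ l, Real.exp (β * g l) - Real.exp (β * g j))) := by
    funext t
    simp only [softmax, hden, Function.update_self]
  rw [key]
  refine (hnum.fun_div (hnum.add_const _) (by simpa using hS.ne')).congr_deriv ?_
  rw [add_sub_cancel, softmax]
  field_simp

lemma sq_softmaxMean_le [Nonempty ι] (g : ι → ℝ) :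
    softmaxMean β g ^ 2 ≤ ∑ j, softmax β g j * g j ^ 2 := by
  exact Real.pow_arith_mean_le_arith_mean_pow_of_even _ _ _ (fun j _ => softmax_nonneg β g j)
    (sum_softmax β g) even_two

/-- A log-sum-exp type bound for the softmax second moment. -/
lemma mul_sq_softmaxMean_le [Nonempty ι] (g : ι → ℝ) {c : ℝ} (hc : 0 ≤ c) :
    c * softmaxMean β g ^ 2 ≤ Real.log (Fintype.card ι)
      + ∑ l, Real.exp (c * g l ^ 2) / Fintype.card ι := by
  have hN : (0 : ℝ) < Fintype.card ι := by exact_mod_cast Fintype.card_pos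
  -- The inequality 1 + y ≤ e^y at y = c g_j² - log N.
  have h1 : ∀ j, c * g j ^ 2 ≤ Real.log (Fintype.card ι)
      + Real.exp (c * g j ^ 2) / Fintype.card ι := by
    intro j
    have := Real.add_one_le_exp (c * g j ^ 2 - Real.log (Fintype.card ι))
    rw [Real.exp_sub, Real.exp_log hN] at this
    linarith
  calc c * softmaxMean β g ^ 2 ≤ c * ∑ j, softmax β g j * g j ^ 2 := by
        gcongr; exact sq_softmaxMean_le β g
    _ = ∑ j, softmax β g j * (c * g j ^ 2) := by
        rw [Finset.mul_sum]; exact Finset.sum_congr rfl fun _ _ => by ring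
    _ ≤ ∑ j, softmax β g j * (Real.log (Fintype.card ι)
          + ∑ l, Real.exp (c * g l ^ 2) / Fintype.card ι) := by
        refine Finset.sum_le_sum fun j _ => mul_le_mul_of_nonneg_left ?_ (softmax_nonneg β g j)
        refine (h1 j).trans (add_le_add_right ?_ _)
        -- Enlarging one term to the whole sum removes the dependence on j, so the weights then sum
        -- out to 1.
        exact Finset.single_le_sum (f := fun l => Real.exp (c * g l ^ 2) / Fintype.card ι)
          (fun _ _ => by positivity) (Finset.mem_univ j)
    _ = _ := by rw [← Finset.sum_mul, sum_softmax, one_mul]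

end Softmax

/-! ### Gaussian integration by parts -/

section Stein

/-- Gaussian integration by parts. -/
lemma integral_mul_gaussianReal_eq_integral_deriv {f f' : ℝ → ℝ}
    (hf : ∀ x, HasDerivAt f (f' x) x) {C : ℝ} (hC : ∀ x, |f x| ≤ C) (hC' : ∀ x, |f' x| ≤ C) :
    ∫ x, x * f x ∂gaussianReal 0 1 = ∫ x, f' x ∂gaussianReal 0 1 := by
  have hfm : Continuous f := continuous_iff_continuousAt.2 fun x => (hf x).continuousAt
  have hf'm : Measurable f' := by
    have : f' = deriv f := funext fun x => (hf x).deriv.symm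
    rw [this]; exact measurable_deriv f
  have hd : ∀ x, HasDerivAt (gaussianPDFReal 0 1) (-(x * gaussianPDFReal 0 1 x)) x := by
    intro x
    rw [gaussianPDFReal_def]
    have h : HasDerivAt (fun y : ℝ => -(y - 0) ^ 2 / (2 * ((1 : NNReal) : ℝ))) (-x) x := by
      have := (((hasDerivAt_id x).sub_const 0).pow 2).neg.div_const (2 * ((1 : NNReal) : ℝ))
      refine this.congr_deriv ?_
      simp
      ring
    refine (h.exp.const_mul _).congr_deriv ?_
    ring
  have hxp : Integrable fun x => x * gaussianPDFReal 0 1 x := by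
    have := integrable_mul_exp_neg_mul_sq (b := 1 / 2) (by norm_num)
    refine (this.const_mul (√(2 * Real.pi * ((1 : NNReal) : ℝ)))⁻¹).congr (ae_of_all _ fun x => ?_)
    simp only [gaussianPDFReal_def, NNReal.coe_one, sub_zero]
    rw [show -(1 / 2 : ℝ) * x ^ 2 = -x ^ 2 / (2 * 1) by ring]
    ring
  have hp : Integrable (gaussianPDFReal 0 1) := integrable_gaussianPDFReal 0 1
  have i1 : Integrable fun x => f' x * gaussianPDFReal 0 1 x :=
    hp.bdd_mul hf'm.aestronglyMeasurable (ae_of_all _ hC')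
  have i2 : Integrable fun x => f x * (-(x * gaussianPDFReal 0 1 x)) :=
    hxp.neg.bdd_mul hfm.aestronglyMeasurable (ae_of_all _ hC)
  have i0 : Integrable fun x => f x * gaussianPDFReal 0 1 x :=
    hp.bdd_mul hfm.aestronglyMeasurable (ae_of_all _ hC)
  -- With p the density, p' = -xp, so (fp)' = f'p - xfp; this integrates to zero.
  have key := integral_eq_zero_of_hasDerivAt_of_integrable
    (fun x => (hf x).mul (hd x)) (i1.add i2) i0
  rw [integral_add i1 i2] at key
  rw [integral_gaussianReal_eq_integral_smul one_ne_zero,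
    integral_gaussianReal_eq_integral_smul one_ne_zero]
  simp only [smul_eq_mul]
  have e2 : ∫ x, f x * (-(x * gaussianPDFReal 0 1 x))
      = - ∫ x, gaussianPDFReal 0 1 x * (x * f x) := by
    rw [← integral_neg]; exact integral_congr_ae (ae_of_all _ fun x => by ring)
  have e1 : ∫ x, f' x * gaussianPDFReal 0 1 x = ∫ x, gaussianPDFReal 0 1 x * f' x :=
    integral_congr_ae (ae_of_all _ fun x => mul_comm _ _)
  linarith

/-- Gaussian integration by parts in one coordinate of a standard Gaussian vector. -/
lemma integral_mul_pi_gaussianReal_eq_integral_deriv {N : ℕ} (j : Fin N)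
    {F F' : (Fin N → ℝ) → ℝ} (hFm : Measurable F) (hFm' : Measurable F')
    (hF : ∀ g, HasDerivAt (fun t => F (Function.update g j t)) (F' g) (g j))
    {C : ℝ} (hC : ∀ g, |F g| ≤ C) (hC' : ∀ g, |F' g| ≤ C) :
    ∫ g, g j * F g ∂Measure.pi (fun _ : Fin N => gaussianReal 0 1)
      = ∫ g, F' g ∂Measure.pi (fun _ : Fin N => gaussianReal 0 1) := by
  obtain _ | n := N
  · exact j.elim0
  have hmp := (measurePreserving_piFinSuccAbove
    (fun _ : Fin (n + 1) => gaussianReal 0 1) j).symm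
  rw [← hmp.integral_comp', ← hmp.integral_comp']
  have hint : Integrable (fun g : Fin (n + 1) → ℝ => g j)
      (Measure.pi fun _ : Fin (n + 1) => gaussianReal 0 1) :=
    (measurePreserving_eval (fun _ : Fin (n + 1) => gaussianReal 0 1) j).integrable_comp_of_integrable
      IsGaussian.integrable_id
  have j1 : Integrable (fun g => g j * F g)
      (Measure.pi fun _ : Fin (n + 1) => gaussianReal 0 1) :=
    hint.mul_bdd (c := C) hFm.aestronglyMeasurable (ae_of_all _ hC)
  have j2 : Integrable F' (Measure.pi fun _ : Fin (n + 1) => gaussianReal 0 1) :=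
    Integrable.of_bound hFm'.aestronglyMeasurable C (ae_of_all _ hC')
  have k1 := hmp.integrable_comp_of_integrable j1
  have k2 := hmp.integrable_comp_of_integrable j2
  simp only [Function.comp_def] at k1 k2
  -- Coordinate j is integrated innermost, with the other coordinates h frozen, so the
  -- one-dimensional identity applies for each h.
  rw [integral_prod_symm _ k1, integral_prod_symm _ k2]
  refine integral_congr_ae (ae_of_all _ fun h => ?_)
  have hupd : ∀ x t : ℝ, Function.update (j.insertNth (α := fun _ => ℝ) x h) j t
      = j.insertNth (α := fun _ => ℝ) t h := fun x t => by simp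
  have := integral_mul_gaussianReal_eq_integral_deriv
    (f := fun x => F (j.insertNth (α := fun _ => ℝ) x h))
    (f' := fun x => F' (j.insertNth (α := fun _ => ℝ) x h)) (C := C)
    (fun x => by simpa [hupd] using hF (j.insertNth (α := fun _ => ℝ) x h))
    (fun x => hC _) (fun x => hC' _)
  simpa [MeasurableEquiv.piFinSuccAbove_symm_apply, Fin.insertNthEquiv] using this

end Stein

/-! ### Moments of the softmax average of standard Gaussians -/

section GaussianSoftmax

/-- The standard Gaussian measure on `ℝᴺ`, as a product measure. -/
abbrev stdGauss (N : ℕ) : Measure (Fin N → ℝ) := Measure.pi fun _ : Fin N => gaussianReal 0 1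

lemma memLp_softmax_mul {Ω ι : Type*} [MeasurableSpace Ω] [Fintype ι] {P : Measure Ω} (β : ℝ)
    {g : Ω → ι → ℝ} (hg : Measurable g) {f : Ω → ℝ} (hf : MemLp f 2 P) (j : ι) :
    MemLp (fun ω => softmax β (g ω) j * f ω) 2 P :=
  hf.of_le (((measurable_softmax β j).comp hg).aestronglyMeasurable.mul hf.1)
    (ae_of_all _ fun ω => by
      rw [norm_mul]
      exact mul_le_of_le_one_left (norm_nonneg _) (abs_softmax_le_one β (g ω) j))

lemma memLp_eval_pi_gaussianReal (N : ℕ) (j : Fin N) (v : NNReal) :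
    MemLp (fun g : Fin N → ℝ => g j) 2 (Measure.pi fun _ : Fin N => gaussianReal 0 v) :=
  (IsGaussian.memLp_two_id (μ := gaussianReal 0 v)).comp_measurePreserving
    (measurePreserving_eval (fun _ : Fin N => gaussianReal 0 v) j)

lemma memLp_softmaxMean (N : ℕ) (β : ℝ) : MemLp (softmaxMean β) 2 (stdGauss N) := by
  unfold softmaxMean
  exact memLp_finsetSum _ fun j _ =>
    memLp_softmax_mul β measurable_id (memLp_eval_pi_gaussianReal N j 1) j

/-- `β (1 - 𝔼 ∑ λ_j²) = 𝔼 ∑ λ_j G_j` for the softmax weights of a standard Gaussian vector. -/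
lemma integral_softmaxMean (N : ℕ) [NeZero N] (β : ℝ) :
    ∫ g, softmaxMean β g ∂stdGauss N
      = β * (1 - ∫ g, ∑ j, softmax β g j ^ 2 ∂stdGauss N) := by
  have hb : ∀ j, Integrable (fun g : Fin N → ℝ => softmax β g j) (stdGauss N) := fun j =>
    Integrable.of_bound (measurable_softmax β j).aestronglyMeasurable 1
      (ae_of_all _ fun g => abs_softmax_le_one β g j)
  have hb2 : ∀ j, Integrable (fun g : Fin N → ℝ => softmax β g j ^ 2) (stdGauss N) := fun j =>
    Integrable.of_bound ((measurable_softmax β j).pow_const 2).aestronglyMeasurable 1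
      (ae_of_all _ fun g => by
        rw [norm_pow]
        exact pow_le_one₀ (norm_nonneg _) (abs_softmax_le_one β g j))
  have h1 : ∀ j, ∫ g, softmax β g j * g j ∂stdGauss N
      = ∫ g, β * (softmax β g j - softmax β g j ^ 2) ∂stdGauss N := by
    intro j
    -- The bound 1 serves the weight and |β| its derivative β(λ - λ²), since 0 ≤ λ ≤ 1.
    rw [← integral_mul_pi_gaussianReal_eq_integral_deriv (N := N) j (F := fun g => softmax β g j)
      (C := max 1 |β|) (by fun_prop) (by fun_prop) (fun g => hasDerivAt_softmax_update β g j)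
      (fun g => (abs_softmax_le_one β g j).trans (le_max_left _ _)) (fun g => ?_)]
    · exact integral_congr_ae (ae_of_all _ fun g => mul_comm _ _)
    · refine le_trans ?_ (le_max_right _ _)
      rw [abs_mul]
      refine mul_le_of_le_one_right (abs_nonneg _) (abs_le.2 ⟨?_, ?_⟩) <;>
        nlinarith [softmax_nonneg β g j, softmax_le_one β g j]
  have h0 : ∀ j, Integrable (fun g : Fin N → ℝ => softmax β g j * g j) (stdGauss N) := fun j =>
    (memLp_softmax_mul β measurable_id
      (memLp_eval_pi_gaussianReal N j 1) j).integrable one_le_two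
  unfold softmaxMean
  rw [integral_finsetSum _ fun j _ => h0 j, Finset.sum_congr rfl fun j _ => h1 j,
    integral_finsetSum _ fun j _ => hb2 j]
  simp_rw [integral_const_mul]
  rw [← Finset.mul_sum, Finset.sum_congr rfl fun j _ => integral_sub (hb j) (hb2 j),
    Finset.sum_sub_distrib, ← integral_finsetSum _ fun j _ => hb j]
  simp [sum_softmax]

/-- The softmax average of `N` standard Gaussians has second moment `O(1 + log N)`. -/
lemma exists_integral_sq_softmaxMean_le :
    ∃ C : ℝ, 0 < C ∧ ∀ (N : ℕ) [NeZero N] (β : ℝ),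
      ∫ g, softmaxMean β g ^ 2 ∂stdGauss N ≤ C * (1 + Real.log N) := by
  -- Fernique: exp(c x²) is integrable for some c > 0.
  obtain ⟨c, hc, hint⟩ := IsGaussian.exists_integrable_exp_sq (gaussianReal 0 1)
  simp only [Real.norm_eq_abs, sq_abs] at hint
  set K := ∫ x, Real.exp (c * x ^ 2) ∂gaussianReal 0 1
  have hK : 0 ≤ K := integral_nonneg fun x => (Real.exp_pos _).le
  -- The argument yields c 𝔼S² ≤ log N + K, which is at most (K + 1)(1 + log N).
  refine ⟨(K + 1) / c, by positivity, fun N _ β => ?_⟩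
  have hN : (0 : ℝ) < N := by exact_mod_cast NeZero.pos N
  have hlog : 0 ≤ Real.log N := Real.log_natCast_nonneg N
  have hl : ∀ l : Fin N, Integrable (fun g : Fin N → ℝ => Real.exp (c * g l ^ 2) / N)
      (stdGauss N) := fun l =>
    ((measurePreserving_eval (fun _ : Fin N => gaussianReal 0 1) l).integrable_comp_of_integrable
      hint).div_const _
  have h1 : ∫ g, c * softmaxMean β g ^ 2 ∂stdGauss N
      ≤ ∫ g, (Real.log N + ∑ l, Real.exp (c * g l ^ 2) / N) ∂stdGauss N := by
    refine integral_mono ((memLp_softmaxMean N β).integrable_sq.const_mul c)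
      ((integrable_const _).add (integrable_finsetSum _ fun l _ => hl l)) fun g => ?_
    simpa using mul_sq_softmaxMean_le β g hc.le
  rw [integral_const_mul, integral_add (integrable_const _)
    (integrable_finsetSum _ fun l _ => hl l), integral_finsetSum _ fun l _ => hl l] at h1
  have h2 : ∀ l : Fin N, ∫ g, Real.exp (c * g l ^ 2) / N ∂stdGauss N = K / N := by
    intro l
    rw [integral_div, integral_comp_eval (μ := fun _ : Fin N => gaussianReal 0 1) (i := l)
      (f := fun x => Real.exp (c * x ^ 2)) hint.1]
  simp only [h2, integral_const, probReal_univ, smul_eq_mul, one_mul, Finset.sum_const,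
    Finset.card_univ, Fintype.card_fin, nsmul_eq_mul, mul_div_cancel₀ _ hN.ne'] at h1
  rw [div_mul_eq_mul_div, le_div_iff₀ hc]
  nlinarith

end GaussianSoftmax

/-! ### Mean and variance after regression -/

section SelfNormalized

/-- The softmax average of the quantities `μ + k g_j + r_j`, for `y = (g, r)`. -/
def softmaxAffine {N : ℕ} (β μ k : ℝ) (y : (Fin N → ℝ) × (Fin N → ℝ)) : ℝ :=
  ∑ j, softmax β y.1 j * (μ + k * y.1 j + y.2 j)

variable {N : ℕ} (β μ k : ℝ) (v : NNReal)

/-- Since the weights sum to 1, the average splits into a function of g alone and a term which,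
given g, is linear in the centred residuals. -/
lemma softmaxAffine_eq [NeZero N] (y : (Fin N → ℝ) × (Fin N → ℝ)) :
    softmaxAffine β μ k y = (μ + k * softmaxMean β y.1) + ∑ j, softmax β y.1 j * y.2 j := by
  simp only [softmaxAffine, softmaxMean, mul_add, Finset.sum_add_distrib, ← Finset.sum_mul,
    sum_softmax, one_mul, Finset.mul_sum]
  congr 2
  exact Finset.sum_congr rfl fun _ _ => by ring

lemma memLp_softmaxAffine :
    MemLp (softmaxAffine (N := N) β μ k) 2
      ((stdGauss N).prod (Measure.pi fun _ : Fin N => gaussianReal 0 v)) := by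
  unfold softmaxAffine
  refine memLp_finsetSum _ fun j _ => memLp_softmax_mul β measurable_fst ?_ j
  refine ((memLp_const μ).add (MemLp.const_mul ?_ k)).add ?_
  · exact (memLp_eval_pi_gaussianReal N j 1).comp_fst _
  · exact (memLp_eval_pi_gaussianReal N j v).comp_snd _

lemma integral_sum_mul_pi_gaussianReal (c : Fin N → ℝ) :
    ∫ r, ∑ j, c j * r j ∂Measure.pi (fun _ : Fin N => gaussianReal 0 v) = 0 := by
  rw [integral_finsetSum _ fun j _ =>
    ((memLp_eval_pi_gaussianReal N j v).integrable one_le_two).const_mul (c j)]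
  refine Finset.sum_eq_zero fun j _ => ?_
  rw [integral_const_mul, integral_comp_eval (μ := fun _ : Fin N => gaussianReal 0 v) (i := j)
    (f := fun x => x) (by fun_prop)]
  simp

lemma integral_sq_sum_mul_pi_gaussianReal (c : Fin N → ℝ) :
    ∫ r, (∑ j, c j * r j) ^ 2 ∂Measure.pi (fun _ : Fin N => gaussianReal 0 v)
      = v * ∑ j, c j ^ 2 := by
  have hL : MemLp (fun r : Fin N → ℝ => ∑ j, c j * r j) 2
      (Measure.pi fun _ : Fin N => gaussianReal 0 v) :=
    memLp_finsetSum _ fun j _ => (memLp_eval_pi_gaussianReal N j v).const_mul (c j)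
  have h1 := variance_eq_sub hL
  rw [integral_sum_mul_pi_gaussianReal] at h1
  have h2 := variance_sum_pi (μ := fun _ : Fin N => gaussianReal 0 v)
    (X := fun j x => c j * x) fun j => (IsGaussian.memLp_two_id (μ := gaussianReal 0 v)).const_mul _
  have h3 : (∑ j, fun ω : Fin N → ℝ => c j * ω j) = fun r => ∑ j, c j * r j := by
    ext r; simp
  rw [h3, h1] at h2
  have h4 : ∀ j, Var[fun x : ℝ => c j * x; gaussianReal 0 v] = c j ^ 2 * v := fun j => by
    rw [variance_const_mul, variance_fun_id_gaussianReal]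
  simp only [h4] at h2
  rw [Finset.mul_sum]
  simpa [mul_comm] using h2

lemma integral_softmaxAffine [NeZero N] :
    ∫ y, softmaxAffine β μ k y
        ∂(stdGauss N).prod (Measure.pi fun _ : Fin N => gaussianReal 0 v)
      = μ + k * ∫ g, softmaxMean β g ∂stdGauss N := by
  rw [integral_prod _ ((memLp_softmaxAffine β μ k v).integrable one_le_two)]
  have h : ∀ g : Fin N → ℝ, ∫ r, softmaxAffine β μ k (g, r)
      ∂Measure.pi (fun _ : Fin N => gaussianReal 0 v) = μ + k * softmaxMean β g := by
    intro g
    simp only [softmaxAffine_eq]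
    rw [integral_add (integrable_const _) (integrable_finsetSum _ fun j _ =>
      ((memLp_eval_pi_gaussianReal N j v).integrable one_le_two).const_mul _),
      integral_sum_mul_pi_gaussianReal]
    simp
  simp only [h]
  rw [integral_add (integrable_const _)
    (((memLp_softmaxMean N β).integrable one_le_two).const_mul k), integral_const_mul]
  simp

/-- Given g, the residual term has mean zero and variance v ∑ λ_j², so the cross term vanishes when
r is integrated out. -/
lemma variance_softmaxAffine [NeZero N] :
    Var[softmaxAffine β μ k; (stdGauss N).prod (Measure.pi fun _ : Fin N => gaussianReal 0 v)]
      = k ^ 2 * Var[softmaxMean β; stdGauss N]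
        + v * ∫ g, ∑ j, softmax β g j ^ 2 ∂stdGauss N := by
  have hL := memLp_softmaxAffine (N := N) β μ k v
  have hS := memLp_softmaxMean N β
  have hS1 := hS.integrable one_le_two
  have hQ : Integrable (fun g : Fin N → ℝ => ∑ j, softmax β g j ^ 2) (stdGauss N) :=
    integrable_finsetSum _ fun j _ =>
      Integrable.of_bound ((measurable_softmax β j).pow_const 2).aestronglyMeasurable 1
        (ae_of_all _ fun g => by
          rw [norm_pow]
          exact pow_le_one₀ (norm_nonneg _) (abs_softmax_le_one β g j))
  rw [variance_eq_sub hL, variance_eq_sub hS, integral_softmaxAffine]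
  have h : ∀ g : Fin N → ℝ, ∫ r, softmaxAffine β μ k (g, r) ^ 2
      ∂Measure.pi (fun _ : Fin N => gaussianReal 0 v)
      = (μ ^ 2 + 2 * μ * k * softmaxMean β g + k ^ 2 * softmaxMean β g ^ 2)
        + v * ∑ j, softmax β g j ^ 2 := by
    intro g
    have hW : MemLp (fun r : Fin N → ℝ => ∑ j, softmax β g j * r j) 2
        (Measure.pi fun _ : Fin N => gaussianReal 0 v) :=
      memLp_finsetSum _ fun j _ => (memLp_eval_pi_gaussianReal N j v).const_mul _
    have e : ∀ r : Fin N → ℝ, softmaxAffine β μ k (g, r) ^ 2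
        = ((μ + k * softmaxMean β g) ^ 2
            + 2 * (μ + k * softmaxMean β g) * ∑ j, softmax β g j * r j)
          + (∑ j, softmax β g j * r j) ^ 2 := fun r => by rw [softmaxAffine_eq]; ring
    simp only [e]
    rw [integral_add ((integrable_const _).fun_add ((hW.integrable one_le_two).const_mul _))
        hW.integrable_sq, integral_add (integrable_const _) ((hW.integrable one_le_two).const_mul _),
      integral_const_mul, integral_sum_mul_pi_gaussianReal, integral_sq_sum_mul_pi_gaussianReal]
    simp
    ring
  have e2 : ∫ y, (softmaxAffine β μ k ^ 2) y
        ∂(stdGauss N).prod (Measure.pi fun _ : Fin N => gaussianReal 0 v)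
      = μ ^ 2 + 2 * μ * k * ∫ g, softmaxMean β g ∂stdGauss N
        + k ^ 2 * ∫ g, softmaxMean β g ^ 2 ∂stdGauss N
        + v * ∫ g, ∑ j, softmax β g j ^ 2 ∂stdGauss N := by
    simp only [Pi.pow_apply]
    rw [integral_prod _ hL.integrable_sq]
    simp only [h]
    rw [integral_add (((integrable_const _).fun_add (hS1.const_mul _)).fun_add
        (hS.integrable_sq.const_mul _)) (hQ.const_mul _),
      integral_add ((integrable_const _).fun_add (hS1.const_mul _)) (hS.integrable_sq.const_mul _),
      integral_add (integrable_const _) (hS1.const_mul _)]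
    simp only [integral_const_mul]
    simp
  rw [e2]
  simp only [Pi.pow_apply]
  ring

end SelfNormalized

/-! ### Gaussian pairs and self-normalized averages -/

section GaussianPair

variable {E : Type*} [MeasurableSpace E] {P : Measure E} {X Y : E → ℝ}

/-- Coordinatewise i.i.d. copies of an independent pair. -/
lemma hasLaw_pi_prod {G R : E → ℝ} {γ ρ : Measure ℝ} [IsProbabilityMeasure P]
    [IsProbabilityMeasure γ] [IsProbabilityMeasure ρ] (N : ℕ)
    (h : HasLaw (fun ω => (G ω, R ω)) (γ.prod ρ) P) :
    HasLaw (fun ε : Fin N → E => ((fun j => G (ε j)), fun j => R (ε j)))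
      ((Measure.pi fun _ : Fin N => γ).prod (Measure.pi fun _ : Fin N => ρ))
      (Measure.pi fun _ : Fin N => P) := by
  have h1 : HasLaw (fun (ε : Fin N → E) j => (G (ε j), R (ε j)))
      (Measure.pi fun _ : Fin N => γ.prod ρ) (Measure.pi fun _ : Fin N => P) := by
    refine ⟨aemeasurable_pi_lambda _ fun j => h.aemeasurable.comp_quasiMeasurePreserving
      (measurePreserving_eval (fun _ : Fin N => P) j).quasiMeasurePreserving, ?_⟩
    have : ∀ _ : Fin N, SigmaFinite (P.map fun ω => (G ω, R ω)) := fun _ => by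
      rw [h.map_eq]; infer_instance
    rw [Measure.pi_map_pi (μ := fun _ : Fin N => P) (f := fun _ ω => (G ω, R ω))
      fun _ => h.aemeasurable, h.map_eq]
  have h2 := measurePreserving_arrowProdEquivProdArrow ℝ ℝ (Fin N) (fun _ => γ) (fun _ => ρ)
  exact (HasLaw.comp ⟨h2.aemeasurable, h2.map_eq⟩ h1 :)

lemma hasLaw_sub_integral_of_hasGaussianLaw (h : HasGaussianLaw X P) :
    HasLaw (fun ω => X ω - P[X]) (gaussianReal 0 Var[X; P].toNNReal) P := by
  simpa using gaussianReal_sub_const ⟨h.aemeasurable, h.map_eq_gaussianReal⟩ P[X]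

/-- Regression of one component of a Gaussian pair on the other one: the standardized first
component and the residual are independent. -/
lemma hasLaw_regression (h : HasGaussianLaw (fun ω => (X ω, Y ω)) P) (hX : 0 < Var[X; P]) :
    (cov[X, Y; P] / √Var[X; P]) ^ 2 ≤ Var[Y; P] ∧
    HasLaw (fun ω => ((X ω - P[X]) / √Var[X; P],
        Y ω - P[Y] - cov[X, Y; P] / √Var[X; P] * ((X ω - P[X]) / √Var[X; P])))
      ((gaussianReal 0 1).prod
        (gaussianReal 0 (Var[Y; P] - (cov[X, Y; P] / √Var[X; P]) ^ 2).toNNReal)) P := by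
  have := h.isProbabilityMeasure
  have hXL : MemLp X 2 P := h.fst.memLp_two
  have hYL : MemLp Y 2 P := h.snd.memLp_two
  set B := √Var[X; P] with hB
  have hBpos : 0 < B := Real.sqrt_pos.2 hX
  have hB2 : Var[X; P] = B ^ 2 := (Real.sq_sqrt hX.le).symm
  set k := cov[X, Y; P] / B with hk
  have hcov : cov[X, Y; P] = k * B := by rw [hk]; field_simp
  -- The coefficient k/B = cov(X, Y)/𝕍X makes Z uncorrelated with X, hence independent of it by
  -- joint Gaussianity.
  set Z : E → ℝ := fun ω => Y ω - k / B * X ω with hZ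
  have hXZ : HasGaussianLaw (fun ω => (X ω, Z ω)) P :=
    h.map_fun ((ContinuousLinearMap.fst ℝ ℝ ℝ).prod
      (ContinuousLinearMap.snd ℝ ℝ ℝ - (k / B) • ContinuousLinearMap.fst ℝ ℝ ℝ))
  have hcov0 : cov[X, Z; P] = 0 := by
    rw [hZ, covariance_fun_sub_right hXL hYL (hXL.const_mul _), covariance_const_mul_right,
      covariance_self hXL.aemeasurable, hB2, hcov]
    field_simp
    ring
  have hvarZ : Var[Z; P] = Var[Y; P] - k ^ 2 := by
    rw [hZ, variance_fun_sub hYL (hXL.const_mul _), covariance_const_mul_right, covariance_comm,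
      variance_const_mul, hB2, hcov]
    field_simp
    ring
  have hmeanZ : P[Z] = P[Y] - k / B * P[X] := by
    rw [hZ, integral_sub (hYL.integrable one_le_two) ((hXL.integrable one_le_two).const_mul _),
      integral_const_mul]
  refine ⟨by have := variance_nonneg Z P; linarith, ?_⟩
  have hind : IndepFun (fun ω => (X ω - P[X]) / B) (fun ω => Z ω - P[Z]) P :=
    (hXZ.indepFun_of_covariance_eq_zero hcov0).comp
      (φ := fun x => (x - P[X]) / B) (ψ := fun z => z - ∫ ω, Z ω ∂P) (by fun_prop) (by fun_prop)
  have hlawG : HasLaw (fun ω => (X ω - P[X]) / B) (gaussianReal 0 1) P := by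
    have := gaussianReal_div_const (hasLaw_sub_integral_of_hasGaussianLaw h.fst) B
    convert this using 2
    · simp
    · rw [← NNReal.coe_inj, NNReal.coe_div, Real.coe_toNNReal _ (variance_nonneg _ _), hB2]
      simp [hBpos.ne']
  have hlawR : HasLaw (fun ω => Z ω - P[Z]) (gaussianReal 0 (Var[Y; P] - k ^ 2).toNNReal) P :=
    hvarZ ▸ hasLaw_sub_integral_of_hasGaussianLaw hXZ.snd
  have e : (fun ω => ((X ω - P[X]) / B, Y ω - P[Y] - k * ((X ω - P[X]) / B)))
      = fun ω => ((X ω - P[X]) / B, Z ω - P[Z]) := by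
    funext ω
    rw [Prod.mk.injEq, hmeanZ]
    simp only [hZ, true_and]
    ring
  rw [e]
  exact ⟨hlawG.aemeasurable.prodMk hlawR.aemeasurable, by
    rw [(indepFun_iff_map_prod_eq_prod_map_map hlawG.aemeasurable hlawR.aemeasurable).1 hind,
      hlawG.map_eq, hlawR.map_eq]⟩

/-- The self-normalized importance sampling average of `Y`, with weights `exp (κ X)`. -/
def selfNormalized (κ : ℝ) (X Y : E → ℝ) (N : ℕ) (ε : Fin N → E) : ℝ :=
  ∑ j, softmax κ (fun l => X (ε l)) j * Y (ε j)

/-- First two moments of a self-normalized average over i.i.d. copies of a Gaussian pair. -/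
lemma selfNormalized_moments (h : HasGaussianLaw (fun ω => (X ω, Y ω)) P) (hX : 0 < Var[X; P])
    (κ : ℝ) (N : ℕ) [NeZero N] :
    MemLp (selfNormalized κ X Y N) 2 (Measure.pi fun _ : Fin N => P) ∧
    ∫ ε, selfNormalized κ X Y N ε ∂Measure.pi (fun _ : Fin N => P)
      = P[Y] + cov[X, Y; P] / √Var[X; P]
          * ∫ g, softmaxMean (κ * √Var[X; P]) g ∂stdGauss N ∧
    Var[selfNormalized κ X Y N; Measure.pi fun _ : Fin N => P]
      = (cov[X, Y; P] / √Var[X; P]) ^ 2 * Var[softmaxMean (κ * √Var[X; P]); stdGauss N]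
        + (Var[Y; P] - (cov[X, Y; P] / √Var[X; P]) ^ 2)
          * ∫ g, ∑ j, softmax (κ * √Var[X; P]) g j ^ 2 ∂stdGauss N := by
  have := h.isProbabilityMeasure
  obtain ⟨hle, hlaw⟩ := hasLaw_regression h hX
  have hT := hasLaw_pi_prod N hlaw
  set B := √Var[X; P] with hB
  have hBpos : 0 < B := Real.sqrt_pos.2 hX
  set k := cov[X, Y; P] / B
  set v := (Var[Y; P] - k ^ 2).toNNReal with hv
  have hvc : (v : ℝ) = Var[Y; P] - k ^ 2 := Real.coe_toNNReal _ (sub_nonneg.2 hle)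
  set T : (Fin N → E) → (Fin N → ℝ) × (Fin N → ℝ) := fun ε =>
    ((fun j => (X (ε j) - P[X]) / B), fun j => Y (ε j) - P[Y] - k * ((X (ε j) - P[X]) / B))
  have hcomp : selfNormalized κ X Y N = softmaxAffine (κ * B) P[Y] k ∘ T := by
    funext ε
    simp only [selfNormalized, softmaxAffine, Function.comp_apply, T]
    refine Finset.sum_congr rfl fun j _ => ?_
    -- Centring X multiplies all weights by the same factor, which cancels on normalization; the
    -- scale B is absorbed in the temperature.
    have e : ∀ l, Real.exp (κ * X (ε l))
        = Real.exp (κ * P[X]) * Real.exp (κ * B * ((X (ε l) - P[X]) / B)) := fun l => by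
      rw [← Real.exp_add]
      congr 1
      field_simp
      ring
    simp only [softmax, e, ← Finset.mul_sum]
    rw [mul_div_mul_left _ _ (Real.exp_ne_zero _)]
    ring
  have hL := memLp_softmaxAffine (N := N) (κ * B) P[Y] k v
  have hm := hL.1
  refine ⟨?_, ?_, ?_⟩
  · rw [hcomp]
    refine MemLp.comp_of_map ?_ hT.aemeasurable
    rwa [hT.map_eq]
  · rw [hcomp, hT.integral_comp hm, integral_softmaxAffine]
  · rw [hcomp, ← variance_map (by rw [hT.map_eq]; exact hm.aemeasurable) hT.aemeasurable,
      hT.map_eq, variance_softmaxAffine, hvc]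

end GaussianPair

/-! ### Limits of Gaussian variables -/

section GaussianLimit

/-- An almost sure limit, dominated in `L²`, of Gaussian random variables is Gaussian. -/
lemma hasGaussianLaw_of_tendsto {E F : Type*} [MeasurableSpace E] {P : Measure E}
    [IsProbabilityMeasure P] [NormedAddCommGroup F] [NormedSpace ℝ F] [MeasurableSpace F]
    [BorelSpace F] [SecondCountableTopology F] [CompleteSpace F] {Z : ℕ → E → F} {Z' : E → F}
    {G : E → ℝ} (hG : Integrable G P) (hZ : ∀ n, HasGaussianLaw (Z n) P)
    (hbound : ∀ n, ∀ᵐ ω ∂P, ‖Z n ω‖ ^ 2 ≤ G ω)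
    (hlim : ∀ᵐ ω ∂P, Tendsto (fun n => Z n ω) atTop (𝓝 (Z' ω))) : HasGaussianLaw Z' P := by
  have hZ'm : AEMeasurable Z' P :=
    aemeasurable_of_tendsto_metrizable_ae atTop (fun n => (hZ n).aemeasurable) hlim
  have hbound' : ∀ᵐ ω ∂P, ‖Z' ω‖ ^ 2 ≤ G ω := by
    filter_upwards [hlim, ae_all_iff.2 hbound] with ω h1 h2
    exact le_of_tendsto (h1.norm.pow 2) (Eventually.of_forall h2)
  have hZ'L : MemLp Z' 2 P := (memLp_two_iff_integrable_sq_norm hZ'm.aestronglyMeasurable).2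
    (hG.mono' (hZ'm.aestronglyMeasurable.norm.pow 2) (by
      filter_upwards [hbound'] with ω h
      simpa using h))
  rw [hasGaussianLaw_iff_charFunDual_map_eq hZ'm]
  intro L
  have hLm : ∀ n, AEStronglyMeasurable (fun ω => L (Z n ω)) P := fun n =>
    (L.continuous.measurable.comp_aemeasurable (hZ n).aemeasurable).aestronglyMeasurable
  have hLlim : ∀ᵐ ω ∂P, Tendsto (fun n => L (Z n ω)) atTop (𝓝 (L (Z' ω))) := by
    filter_upwards [hlim] with ω h using (L.continuous.tendsto _).comp h
  have hL2 : ∀ n, ∀ᵐ ω ∂P, ‖L (Z n ω) ^ 2‖ ≤ ‖L‖ ^ 2 * G ω := by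
    intro n
    filter_upwards [hbound n] with ω h
    rw [norm_pow]
    calc ‖L (Z n ω)‖ ^ 2 ≤ (‖L‖ * ‖Z n ω‖) ^ 2 := by gcongr; exact L.le_opNorm _
      _ = ‖L‖ ^ 2 * ‖Z n ω‖ ^ 2 := by ring
      _ ≤ _ := by gcongr
  have hsq : Tendsto (fun n => ∫ ω, L (Z n ω) ^ 2 ∂P) atTop (𝓝 (∫ ω, L (Z' ω) ^ 2 ∂P)) :=
    tendsto_integral_of_dominated_convergence _ (fun n => (hLm n).pow 2) (hG.const_mul _) hL2
      (by filter_upwards [hLlim] with ω h using h.pow 2)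
  -- The majorant comes from |y| ≤ 1 + y².
  have hmean : Tendsto (fun n => ∫ ω, L (Z n ω) ∂P) atTop (𝓝 (∫ ω, L (Z' ω) ∂P)) := by
    refine tendsto_integral_of_dominated_convergence (fun ω => 1 + ‖L‖ ^ 2 * G ω) hLm
      ((integrable_const _).add (hG.const_mul _)) (fun n => ?_) hLlim
    filter_upwards [hL2 n] with ω h
    rw [norm_pow] at h
    nlinarith [sq_nonneg (‖L (Z n ω)‖ - 1)]
  have hvar : Tendsto (fun n => Var[fun ω => L (Z n ω); P]) atTop
      (𝓝 Var[fun ω => L (Z' ω); P]) := by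
    have h1 : ∀ n, Var[fun ω => L (Z n ω); P] = ∫ ω, L (Z n ω) ^ 2 ∂P
        - (∫ ω, L (Z n ω) ∂P) ^ 2 := fun n => variance_eq_sub ((hZ n).memLp_two.continuousLinearMap_comp L)
    rw [variance_eq_sub (hZ'L.continuousLinearMap_comp L)]
    simp only [h1]
    exact hsq.sub (hmean.pow 2)
  have hchar : Tendsto (fun n => charFunDual (P.map (Z n)) L) atTop
      (𝓝 (charFunDual (P.map Z') L)) := by
    have e : ∀ W : E → F, AEMeasurable W P → charFunDual (P.map W) L
        = ∫ ω, Complex.exp (L (W ω) * Complex.I) ∂P := fun W hW => by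
      rw [charFunDual_apply, integral_map hW (by fun_prop)]
    simp only [e _ (hZ _).aemeasurable, e _ hZ'm]
    refine tendsto_integral_of_dominated_convergence (fun _ => (1 : ℝ)) (fun n => ?_)
      (integrable_const _) (fun n => ae_of_all _ fun ω => ?_) ?_
    · exact (show Continuous fun x : ℝ => Complex.exp (x * Complex.I) by fun_prop
        ).comp_aestronglyMeasurable (hLm n)
    · rw [Complex.norm_exp_ofReal_mul_I]
    · filter_upwards [hLlim] with ω h
      exact ((show Continuous fun x : ℝ => Complex.exp (x * Complex.I) by fun_prop).tendsto _).comp h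
  -- The same characteristic functions also converge through their Gaussian formula, because means
  -- and variances converge.
  refine tendsto_nhds_unique hchar ?_
  simp only [fun n => (hZ n).charFunDual_map_eq_fun L]
  refine (Complex.continuous_exp.tendsto _).comp ?_
  exact (((Complex.continuous_ofReal.tendsto _).comp hmean).mul_const _).sub
    (((Complex.continuous_ofReal.tendsto _).comp hvar).div_const _)

end GaussianLimit

/-! ### Differentiating a Gaussian curve -/

section GaussianCurve

variable {E : Type*} [MeasurableSpace E] {P : Measure E} {X X' : ℝ → E → ℝ} {t₀ r : ℝ}
  {G₁ G₂ : E → ℝ}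

/-- A Gaussian curve and its derivative at a point are jointly Gaussian. -/
lemma hasGaussianLaw_prodMk_deriv [IsProbabilityMeasure P] (hr : 0 < r)
    (hG₁ : Integrable G₁ P)
    (hd : ∀ᵐ ω ∂P, ∀ t ∈ Ioo (t₀ - r) (t₀ + r), HasDerivAt (fun s => X s ω) (X' t ω) t)
    (hX' : ∀ᵐ ω ∂P, ∀ t ∈ Ioo (t₀ - r) (t₀ + r), X' t ω ^ 2 ≤ G₁ ω)
    (hGauss : ∀ t ∈ Ioo (t₀ - r) (t₀ + r), HasGaussianLaw (fun ω => (X t₀ ω, X t ω)) P) :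
    HasGaussianLaw (fun ω => (X t₀ ω, X' t₀ ω)) P := by
  have ht₀ : t₀ ∈ Ioo (t₀ - r) (t₀ + r) := by constructor <;> linarith
  -- Increments tending to 0; starting from r/2 keeps them below r already at n = 0.
  set h : ℕ → ℝ := fun n => r / 2 / (n + 1) with hh
  have hpos : ∀ n, 0 < h n := fun n => by positivity
  have hlt : ∀ n, h n < r := fun n => by
    have : h n ≤ r / 2 := div_le_self (by positivity) (by linarith [n.cast_nonneg (α := ℝ)])
    linarith
  have hmem : ∀ n, t₀ + h n ∈ Ioo (t₀ - r) (t₀ + r) := fun n => by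
    constructor <;> linarith [hpos n, hlt n]
  have hlim0 : Tendsto h atTop (𝓝 0) := by
    have := tendsto_one_div_add_atTop_nhds_zero_nat (𝕜 := ℝ)
    simpa [hh, div_eq_mul_inv] using this.const_mul (r / 2)
  have hX0 : MemLp (X t₀) 2 P := (hGauss t₀ ht₀).fst.memLp_two
  refine hasGaussianLaw_of_tendsto
    (Z := fun n ω => (X t₀ ω, (h n)⁻¹ * (X (t₀ + h n) ω - X t₀ ω)))
    (G := fun ω => X t₀ ω ^ 2 + G₁ ω) (hX0.integrable_sq.add hG₁) (fun n => ?_) (fun n => ?_) ?_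
  · exact (hGauss _ (hmem n)).map_fun ((ContinuousLinearMap.fst ℝ ℝ ℝ).prod
      ((h n)⁻¹ • (ContinuousLinearMap.snd ℝ ℝ ℝ - ContinuousLinearMap.fst ℝ ℝ ℝ)))
  · filter_upwards [hd, hX'] with ω h1 h2
    -- By the mean value theorem the difference quotient is a value of X' inside the interval, so
    -- `G₁` dominates its square.
    obtain ⟨c, hc, hc'⟩ := exists_hasDerivAt_eq_slope (fun s => X s ω) (fun s => X' s ω)
      (show t₀ < t₀ + h n by linarith [hpos n])
      (fun t ht => (h1 t ⟨by linarith [ht.1], by linarith [ht.2, hlt n]⟩).continuousAt.continuousWithinAt)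
      (fun t ht => h1 t ⟨by linarith [ht.1], by linarith [ht.2, hlt n]⟩)
    have e : (h n)⁻¹ * (X (t₀ + h n) ω - X t₀ ω) = X' c ω := by
      rw [hc', add_sub_cancel_left, div_eq_inv_mul]
    have hcI := h2 c ⟨by linarith [hc.1], by linarith [hc.2, hlt n]⟩
    rw [e]
    change max ‖X t₀ ω‖ ‖X' c ω‖ ^ 2 ≤ X t₀ ω ^ 2 + G₁ ω
    rcases max_cases ‖X t₀ ω‖ ‖X' c ω‖ with ⟨hm, _⟩ | ⟨hm, _⟩
    · rw [hm, Real.norm_eq_abs, sq_abs]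
      nlinarith [sq_nonneg (X' c ω)]
    · rw [hm, Real.norm_eq_abs, sq_abs]
      nlinarith [sq_nonneg (X t₀ ω)]
  · filter_upwards [hd] with ω h1
    refine Tendsto.prodMk_nhds tendsto_const_nhds ?_
    have := (hasDerivAt_iff_tendsto_slope_zero.1 (h1 t₀ ht₀)).comp
      (tendsto_nhdsWithin_iff.2 ⟨hlim0, Eventually.of_forall fun n => (hpos n).ne'⟩)
    simpa [Function.comp_def] using this

/-- The derivative of `𝔼 X + 𝕍 X / 2`, the log-moment generating function at `1` of a Gaussian
curve. -/
lemma hasDerivAt_integral_add_half_variance [IsProbabilityMeasure P] (hr : 0 < r)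
    (hG₁ : Integrable G₁ P) (hG₂ : Integrable G₂ P)
    (hd : ∀ᵐ ω ∂P, ∀ t ∈ Ioo (t₀ - r) (t₀ + r), HasDerivAt (fun s => X s ω) (X' t ω) t)
    (hX' : ∀ᵐ ω ∂P, ∀ t ∈ Ioo (t₀ - r) (t₀ + r), X' t ω ^ 2 ≤ G₁ ω)
    (hX : ∀ᵐ ω ∂P, ∀ t ∈ Ioo (t₀ - r) (t₀ + r), X t ω ^ 2 ≤ G₂ ω)
    (hL : ∀ t ∈ Ioo (t₀ - r) (t₀ + r), MemLp (X t) 2 P) (hL' : MemLp (X' t₀) 2 P) :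
    HasDerivAt (fun t => P[X t] + Var[X t; P] / 2) (P[X' t₀] + cov[X t₀, X' t₀; P]) t₀ := by
  have ht₀ : t₀ ∈ Ioo (t₀ - r) (t₀ + r) := by constructor <;> linarith
  have hI : Ioo (t₀ - r) (t₀ + r) ∈ 𝓝 t₀ := isOpen_Ioo.mem_nhds ht₀
  have h1 := (hasDerivAt_integral_of_dominated_loc_of_deriv_le (μ := P) (F := X) (F' := X')
    (bound := fun ω => 1 + G₁ ω) hI
    (by filter_upwards [hI] with t ht using (hL t ht).1) ((hL t₀ ht₀).integrable one_le_two) hL'.1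
    (by
      filter_upwards [hX'] with ω h t ht
      have := h t ht
      rw [← sq_abs] at this
      rw [Real.norm_eq_abs]
      nlinarith [sq_nonneg (|X' t ω| - 1)])
    ((integrable_const _).add hG₁) hd).2
  -- The derivative of X² is dominated through 2|X X'| ≤ X² + X'².
  have h2 := (hasDerivAt_integral_of_dominated_loc_of_deriv_le (μ := P)
    (F := fun t ω => X t ω ^ 2) (F' := fun t ω => 2 * (X t ω * X' t ω))
    (bound := fun ω => G₂ ω + G₁ ω) hI
    (by filter_upwards [hI] with t ht using (hL t ht).1.pow 2) (hL t₀ ht₀).integrable_sq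
    (((hL t₀ ht₀).1.mul hL'.1).const_mul 2)
    (by
      filter_upwards [hX', hX] with ω h h' t ht
      have := h t ht
      have := h' t ht
      rw [Real.norm_eq_abs, abs_le]
      constructor <;> nlinarith [sq_nonneg (X t ω - X' t ω), sq_nonneg (X t ω + X' t ω)])
    (hG₂.add hG₁) (by
      filter_upwards [hd] with ω h t ht
      refine ((h t ht).pow 2).congr_deriv ?_
      push_cast
      ring)).2
  rw [integral_const_mul] at h2
  -- The variance is treated as 𝔼X² - (𝔼X)².
  have h3 := h1.add ((h2.sub (h1.pow 2)).div_const 2)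
  refine (h3.congr_deriv ?_).congr_of_eventuallyEq ?_
  · rw [covariance_eq_sub (hL t₀ ht₀) hL']
    simp only [Pi.mul_apply]
    push_cast
    ring
  · filter_upwards [hI] with t ht
    rw [variance_eq_sub (hL t ht)]
    rfl

end GaussianCurve

/-! ### Moving one component of the parameter -/

namespace Param

variable {a b : ℕ} (ψ : Fin a ⊕ Fin b) (p : Param a b)

@[simp]
lemma comp_replace (t : ℝ) : (p.replace ψ t).comp ψ = t := by
  cases ψ <;> simp [replace, comp]

@[simp]
lemma replace_replace (s t : ℝ) : (p.replace ψ s).replace ψ t = p.replace ψ t := by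
  cases ψ <;> simp [replace]

@[simp]
lemma replace_comp : p.replace ψ (p.comp ψ) = p := by
  cases ψ <;> simp [replace, comp]

lemma pderiv_replace (g : Param a b → ℝ) (t : ℝ) :
    pderiv ψ g (p.replace ψ t) = deriv (fun s => g (p.replace ψ s)) t := by
  simp [pderiv]

lemma differentiable_replace : Differentiable ℝ fun t : ℝ => p.replace ψ t := by
  cases ψ with
  | inl k =>
    exact fun t => (hasDerivAt_update p.1 k t).differentiableAt.prodMk (differentiableAt_const _)
  | inr k =>
    exact fun t => (differentiableAt_const _).prodMk (hasDerivAt_update p.2 k t).differentiableAt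

end Param

/-! ### Log-weights, likelihood and score of the model -/

namespace LatentModel

variable {d a b : ℕ} {E : Type*} [MeasurableSpace E] {M : LatentModel d a b E}

/-- A zero evidence would make the posterior identically 0, by the convention x/0 = 0, against its
a.e. positivity. That positivity is not vacuous: `q` integrates to 1 for some φ ∈ Φ, so ν ≠ 0. -/
lemma Standing.evidence_pos (hM : M.Standing) {p : Param a b} (hp : p ∈ M.Θ ×ˢ M.Φ) :
    0 < M.evidence p.1 := by
  have hν : M.ν ≠ 0 := fun h => by
    have := hM.integral_q p.2 hp.2
    simp [h] at this
  have : (ae M.ν).NeBot := ae_neBot.2 hν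
  obtain ⟨z, hz⟩ := (hM.posterior_pos p.1 hp.1).exists
  have h0 : 0 ≤ M.evidence p.1 := integral_nonneg (hM.joint_nonneg p.1 hp.1)
  refine h0.lt_of_ne fun h => ?_
  simp [posterior, ← h] at hz

lemma Standing.joint_eq (hM : M.Standing) {p : Param a b} (hp : p ∈ M.Θ ×ˢ M.Φ)
    (z : Fin d → ℝ) : M.joint p.1 z = M.posterior p.1 z * M.evidence p.1 :=
  (div_mul_cancel₀ _ (hM.evidence_pos hp).ne').symm

lemma Standing.differentiableAt_posterior (hM : M.Standing) {θ : Fin a → ℝ} (hθ : θ ∈ M.Θ)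
    (z : Fin d → ℝ) :
    DifferentiableAt ℝ (fun y : (Fin d → ℝ) × (Fin a → ℝ) => M.posterior y.2 y.1) (z, θ) :=
  hM.differentiable_posterior.differentiableAt
    ((isOpen_univ.prod hM.isOpen_Θ).mem_nhds ⟨mem_univ _, hθ⟩)

lemma Standing.differentiableAt_q (hM : M.Standing) {φ : Fin b → ℝ} (hφ : φ ∈ M.Φ)
    (z : Fin d → ℝ) :
    DifferentiableAt ℝ (fun y : (Fin d → ℝ) × (Fin b → ℝ) => M.q y.2 y.1) (z, φ) :=
  hM.differentiable_q.differentiableAt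
    ((isOpen_univ.prod hM.isOpen_Φ).mem_nhds ⟨mem_univ _, hφ⟩)

/-- Integrability only gives a.e. measurability for ν. Genuine measurability is recovered from the
posterior, which is differentiable in z. -/
lemma Standing.measurable_joint (hM : M.Standing) {p : Param a b} (hp : p ∈ M.Θ ×ˢ M.Φ) :
    Measurable (M.joint p.1) := by
  have h : Continuous (M.posterior p.1) := continuous_iff_continuousAt.2 fun z =>
    (hM.differentiableAt_posterior hp.1 z).continuousAt.comp (f := fun z => (z, p.1))
      (by fun_prop)
  have e : M.joint p.1 = fun z => M.posterior p.1 z * M.evidence p.1 :=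
    funext fun z => hM.joint_eq hp z
  rw [e]
  exact h.measurable.mul_const _

lemma Standing.measurable_q (hM : M.Standing) {φ : Fin b → ℝ} (hφ : φ ∈ M.Φ) :
    Measurable (M.q φ) :=
  (continuous_iff_continuousAt.2 fun z =>
    (hM.differentiableAt_q hφ z).continuousAt.comp (f := fun z => (z, φ))
      (by fun_prop) : Continuous (M.q φ)).measurable

/-- Importance weights are unbiased for the evidence. -/
lemma Standing.integral_repWeight (hM : M.Standing) {p : Param a b} (hp : p ∈ M.Θ ×ˢ M.Φ) :
    ∫ ε, M.repWeight p.1 p.2 p.2 ε ∂M.noise = M.evidence p.1 := by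
  have hw : Measurable (M.weight p.1 p.2) := (hM.measurable_joint hp).div (hM.measurable_q hp.2)
  have h := (hM.hasLaw_f p.2 hp.2).integral_comp (f := M.weight p.1 p.2) hw.aestronglyMeasurable
  refine h.trans ?_
  rw [integral_withDensity_eq_integral_toReal_smul
    (hM.measurable_q hp.2).ennreal_ofReal (ae_of_all _ fun z => ENNReal.ofReal_lt_top)]
  refine integral_congr_ae ?_
  filter_upwards [hM.q_pos p.2 hp.2] with z hz
  rw [ENNReal.toReal_ofReal hz.le, weight, smul_eq_mul, mul_div_cancel₀ _ hz.ne']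

/-- Almost surely, the log-weight is differentiable in the parameters. -/
lemma Standing.differentiableAt_logWeight (hM : M.Standing) :
    ∀ᵐ ε ∂M.noise, ∀ p ∈ M.Θ ×ˢ M.Φ, DifferentiableAt ℝ (M.logWeight ε) p := by
  filter_upwards [hM.differentiable_f, hM.pos] with ε hf hpos p hp
  obtain ⟨hj, hq⟩ := hpos p.1 hp.1 p.2 hp.2 p.2 hp.2
  have hf' : DifferentiableAt ℝ (fun s : Param a b => M.f ε s.2) p :=
    ((hf p.2 hp.2).differentiableAt (hM.isOpen_Φ.mem_nhds hp.2)).comp p differentiableAt_snd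
  have h1 : DifferentiableAt ℝ (fun s : Param a b => M.posterior s.1 (M.f ε s.2)) p :=
    DifferentiableAt.comp (f := fun s : Param a b => (M.f ε s.2, s.1)) p
      (hM.differentiableAt_posterior hp.1 (M.f ε p.2)) (hf'.prodMk differentiableAt_fst)
  have h2 : DifferentiableAt ℝ (fun s : Param a b => M.q s.2 (M.f ε s.2)) p :=
    DifferentiableAt.comp (f := fun s : Param a b => (M.f ε s.2, s.2)) p
      (hM.differentiableAt_q hp.2 (M.f ε p.2)) (hf'.prodMk differentiableAt_snd)
  have h3 : DifferentiableAt ℝ (fun s : Param a b => M.evidence s.1) p :=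
    ((hM.differentiable_evidence p.1 hp.1).differentiableAt
      (hM.isOpen_Θ.mem_nhds hp.1)).comp p differentiableAt_fst
  -- The joint density is factored as posterior times evidence, the two functions assumed
  -- differentiable; the factorization holds near p because Θ × Φ is open.
  have h4 : DifferentiableAt ℝ (fun s : Param a b => Real.log
      (M.posterior s.1 (M.f ε s.2) * M.evidence s.1 * (M.q s.2 (M.f ε s.2))⁻¹)) p := by
    refine ((h1.fun_mul h3).fun_mul (h2.fun_inv hq.ne')).log ?_
    rw [← hM.joint_eq hp, ← div_eq_mul_inv]
    exact (div_pos hj hq).ne'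
  refine h4.congr_of_eventuallyEq ?_
  filter_upwards [(hM.isOpen_Θ.prod hM.isOpen_Φ).mem_nhds hp] with s hs
  rw [logWeight, repWeight, weight, hM.joint_eq hs, div_eq_mul_inv]

/-- Both indices are taken on the diagonal φ' = φ of the field. -/
lemma IsGaussianField.hasGaussianLaw_prodMk (hG : M.IsGaussianField) {p p' : Param a b}
    (hp : p ∈ M.Θ ×ˢ M.Φ) (hp' : p' ∈ M.Θ ×ˢ M.Φ) :
    HasGaussianLaw (fun ε => (M.logWeight ε p, M.logWeight ε p')) M.noise :=
  IsGaussianProcess.hasGaussianLaw_prodMk hG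
    (s := ⟨(p.1, p.2, p.2), hp.1, hp.2, hp.2⟩) (t := ⟨(p'.1, p'.2, p'.2), hp'.1, hp'.2, hp'.2⟩)

lemma Standing.repWeight_pos (hM : M.Standing) :
    ∀ᵐ ε ∂M.noise, ∀ p ∈ M.Θ ×ˢ M.Φ, 0 < M.repWeight p.1 p.2 p.2 ε := by
  filter_upwards [hM.pos] with ε hpos p hp
  obtain ⟨hj, hq⟩ := hpos p.1 hp.1 p.2 hp.2 p.2 hp.2
  exact div_pos hj hq

/-- The log-likelihood through the mean and the variance of the Gaussian log-weight. -/
lemma Standing.logLik_eq (hM : M.Standing) (hG : M.IsGaussianField) {p : Param a b}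
    (hp : p ∈ M.Θ ×ˢ M.Φ) :
    M.logLik p.1 = ∫ ε, M.logWeight ε p ∂M.noise
      + Var[fun ε => M.logWeight ε p; M.noise] / 2 := by
  have hX := (hG.hasGaussianLaw_prodMk hp hp).fst
  have h := mgf_gaussianReal hX.map_eq_gaussianReal 1
  rw [Real.coe_toNNReal _ (variance_nonneg _ _)] at h
  -- The exponential of the log-weight is the weight, whose mean is the evidence.
  have e : mgf (fun ε => M.logWeight ε p) M.noise 1 = M.evidence p.1 := by
    rw [← hM.integral_repWeight hp, mgf]
    refine integral_congr_ae ?_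
    filter_upwards [hM.repWeight_pos] with ε hε
    rw [one_mul, logWeight, Real.exp_log (hε p hp)]
  rw [logLik, ← e, h, Real.log_exp]
  ring

/-- The log-weight and its partial derivative are jointly Gaussian, and the score is the mean of
the latter plus their covariance. -/
lemma Standing.hasGaussianLaw_pderiv (hM : M.Standing) (hG : M.IsGaussianField)
    {ψ : Fin a ⊕ Fin b} (hD : M.Dominated ψ) {p : Param a b} (hp : p ∈ M.Θ ×ˢ M.Φ) :
    HasGaussianLaw (fun ε => (M.logWeight ε p, Param.pderiv ψ (M.logWeight ε) p)) M.noise ∧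
    Param.pderiv ψ (fun s => M.logLik s.1) p
      = ∫ ε, Param.pderiv ψ (M.logWeight ε) p ∂M.noise
        + cov[fun ε => M.logWeight ε p, fun ε => Param.pderiv ψ (M.logWeight ε) p; M.noise] := by
  have := hM.isProbabilityMeasure_noise
  obtain ⟨V, hV, ⟨r, hr, hrV⟩, ⟨G₁, hG₁, hG₁'⟩, ⟨G₂, hG₂, hG₂'⟩⟩ := hD p hp
  set t₀ := p.comp ψ with ht₀
  have hI : Ioo (t₀ - r) (t₀ + r) ∈ 𝓝 t₀ :=
    isOpen_Ioo.mem_nhds ⟨by linarith, by linarith⟩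
  set X : ℝ → E → ℝ := fun t ε => M.logWeight ε (p.replace ψ t) with hX
  set X' : ℝ → E → ℝ := fun t ε => Param.pderiv ψ (M.logWeight ε) (p.replace ψ t) with hX'
  have hX0 : X t₀ = fun ε => M.logWeight ε p := by simp [hX, ht₀]
  have hX'0 : X' t₀ = fun ε => Param.pderiv ψ (M.logWeight ε) p := by simp [hX', ht₀]
  have hd : ∀ᵐ ε ∂M.noise, ∀ t ∈ Ioo (t₀ - r) (t₀ + r),
      HasDerivAt (fun s => X s ε) (X' t ε) t := by
    filter_upwards [hM.differentiableAt_logWeight] with ε hε t ht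
    simp only [hX', Param.pderiv_replace]
    exact ((hε _ (hV (hrV t ht))).comp t (Param.differentiable_replace ψ p t)).hasDerivAt
  have hb1 : ∀ᵐ ε ∂M.noise, ∀ t ∈ Ioo (t₀ - r) (t₀ + r), X' t ε ^ 2 ≤ G₁ ε := by
    filter_upwards [hG₁'] with ε hε t ht using hε _ (hrV t ht)
  have hb2 : ∀ᵐ ε ∂M.noise, ∀ t ∈ Ioo (t₀ - r) (t₀ + r), X t ε ^ 2 ≤ G₂ ε := by
    filter_upwards [hG₂'] with ε hε t ht using hε _ (hrV t ht)
  have hgauss : HasGaussianLaw (fun ε => (X t₀ ε, X' t₀ ε)) M.noise :=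
    hasGaussianLaw_prodMk_deriv hr hG₁ hd hb1 fun t ht => by
      rw [hX0]
      exact hG.hasGaussianLaw_prodMk hp (hV (hrV t ht))
  have hder := hasDerivAt_integral_add_half_variance hr hG₁ hG₂ hd hb1 hb2
    (fun t ht => (hG.hasGaussianLaw_prodMk hp (hV (hrV t ht))).snd.memLp_two)
    hgauss.snd.memLp_two
  -- Near t₀ the log-likelihood is 𝔼X + 𝕍X/2, so it inherits the derivative. If ψ is a component of
  -- φ, both sides are 0.
  have hlog : HasDerivAt (fun t => M.logLik (p.replace ψ t).1)
      (M.noise[X' t₀] + cov[X t₀, X' t₀; M.noise]) t₀ := by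
    refine hder.congr_of_eventuallyEq ?_
    filter_upwards [hI] with t ht
    exact hM.logLik_eq hG (hV (hrV t ht))
  rw [hX0, hX'0] at hlog
  refine ⟨?_, hlog.deriv⟩
  rw [hX0, hX'0] at hgauss
  exact hgauss

/-- The gradient estimator is a self-normalized average. -/
lemma Standing.gradREP_ae_eq (hM : M.Standing) (α : ℝ) (ψ : Fin a ⊕ Fin b) (N : ℕ)
    {p : Param a b} (hp : p ∈ M.Θ ×ˢ M.Φ) :
    M.gradREP α ψ N p =ᵐ[M.sampleLaw N] selfNormalized (1 - α) (fun ε => M.logWeight ε p)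
      (fun ε => Param.pderiv ψ (M.logWeight ε) p) N := by
  have := hM.isProbabilityMeasure_noise
  have h : ∀ᵐ ε ∂M.sampleLaw N, ∀ j : Fin N, 0 < M.repWeight p.1 p.2 p.2 (ε j) :=
    ae_all_iff.2 fun j => (measurePreserving_eval (fun _ : Fin N => M.noise)
      j).quasiMeasurePreserving.ae (hM.repWeight_pos.mono fun ε hε => hε p hp)
  filter_upwards [h] with ε hε
  have e : ∀ j, M.repWeight p.1 p.2 p.2 (ε j) ^ (1 - α)
      = Real.exp ((1 - α) * M.logWeight (ε j) p) := fun j => by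
    rw [Real.rpow_def_of_pos (hε j), logWeight, mul_comm]
  simp only [gradREP, selfNormalized, softmax, e]

end LatentModel

/-! ### Asymptotics of the signal-to-noise ratio -/

/-- If the mean and the variance of an estimator are `m + k A` and `k² D + (V - k²) Q`, where
`k² L / V → 0`, `Q → 1` and `A²`, `D` are `O(L)`, then its signal-to-noise ratio is asymptotically
that of an estimator with mean `m` and variance `V`. -/
lemma exists_snr_asymptotics {ι : Type*} {l : Filter ι} {m k V A D Q L : ι → ℝ} {C : ℝ}
    (hV : ∀ᶠ i in l, 0 < V i) (hL : Tendsto L l atTop)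
    (hc : Tendsto (fun i => k i ^ 2 / V i * L i) l (𝓝 0))
    (hA : ∀ᶠ i in l, A i ^ 2 ≤ C * (1 + L i)) (hD0 : ∀ᶠ i in l, 0 ≤ D i)
    (hD : ∀ᶠ i in l, D i ≤ C * (1 + L i)) (hQ : Tendsto Q l (𝓝 1)) :
    (∀ᶠ i in l, 0 < k i ^ 2 * D i + (V i - k i ^ 2) * Q i) ∧
    ∃ u v : ι → ℝ, Tendsto u l (𝓝 0) ∧ Tendsto v l (𝓝 0) ∧ ∀ᶠ i in l,
      |m i + k i * A i| / √(k i ^ 2 * D i + (V i - k i ^ 2) * Q i)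
        = |m i| / √(V i) * (1 + u i) + v i := by
  -- Eventually L ≥ 1, so k²/V is below k²L/V.
  have hc1 : Tendsto (fun i => k i ^ 2 / V i) l (𝓝 0) := by
    refine tendsto_of_tendsto_of_tendsto_of_le_of_le' tendsto_const_nhds hc ?_ ?_
    · filter_upwards [hV] with i hi using div_nonneg (sq_nonneg _) hi.le
    · filter_upwards [hV, hL.eventually_ge_atTop 1] with i hi hLi
      exact le_mul_of_one_le_right (div_nonneg (sq_nonneg _) hi.le) hLi
  have hcC : Tendsto (fun i => k i ^ 2 / V i * (C * (1 + L i))) l (𝓝 0) := by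
    have := (hc1.add hc).const_mul C
    simp only [add_zero, mul_zero] at this
    exact this.congr fun i => by ring
  have hcD : Tendsto (fun i => k i ^ 2 / V i * D i) l (𝓝 0) := by
    refine tendsto_of_tendsto_of_tendsto_of_le_of_le' tendsto_const_nhds hcC ?_ ?_
    · filter_upwards [hV, hD0] with i hi hDi using mul_nonneg (div_nonneg (sq_nonneg _) hi.le) hDi
    · filter_upwards [hV, hD] with i hi hDi
      exact mul_le_mul_of_nonneg_left hDi (div_nonneg (sq_nonneg _) hi.le)
  have hcA : Tendsto (fun i => |k i / √(V i) * A i|) l (𝓝 0) := by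
    have h2 : Tendsto (fun i => (k i / √(V i) * A i) ^ 2) l (𝓝 0) := by
      refine tendsto_of_tendsto_of_tendsto_of_le_of_le' tendsto_const_nhds hcC
        (Eventually.of_forall fun i => sq_nonneg _) ?_
      filter_upwards [hV, hA] with i hi hAi
      rw [mul_pow, div_pow, Real.sq_sqrt hi.le]
      exact mul_le_mul_of_nonneg_left hAi (div_nonneg (sq_nonneg _) hi.le)
    simpa [Function.comp_def, Real.sqrt_sq_eq_abs] using (Real.continuous_sqrt.tendsto 0).comp h2
  -- W is the variance divided by V.
  set W : ι → ℝ := fun i => k i ^ 2 / V i * D i + (1 - k i ^ 2 / V i) * Q i with hW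
  have hW1 : Tendsto W l (𝓝 1) := by
    simpa using hcD.add ((hc1.const_sub 1).mul hQ)
  have hWV : ∀ i, 0 < V i → k i ^ 2 * D i + (V i - k i ^ 2) * Q i = V i * W i := fun i hi => by
    simp only [hW]
    field_simp
  have hWpos : ∀ᶠ i in l, 0 < W i := hW1.eventually (lt_mem_nhds one_pos)
  have hsW : Tendsto (fun i => (√(W i))⁻¹) l (𝓝 1) := by
    simpa using ((Real.continuous_sqrt.tendsto 1).comp hW1).inv₀ (by simp)
  -- The factor 1/√W is the relative error; the shift of the mean by kA, in units of √V, gives the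
  -- additive one.
  refine ⟨?_, fun i => (√(W i))⁻¹ - 1,
    fun i => (|m i / √(V i) + k i / √(V i) * A i| - |m i / √(V i)|) * (√(W i))⁻¹, ?_, ?_, ?_⟩
  · filter_upwards [hV, hWpos] with i hi hWi
    rw [hWV i hi]
    exact mul_pos hi hWi
  · simpa using hsW.sub_const 1
  · have : Tendsto (fun i => |m i / √(V i) + k i / √(V i) * A i| - |m i / √(V i)|) l (𝓝 0) := by
      refine squeeze_zero_norm (fun i => ?_) hcA
      have := abs_abs_sub_abs_le_abs_sub (m i / √(V i) + k i / √(V i) * A i) (m i / √(V i))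
      rwa [add_sub_cancel_left] at this
    simpa using this.mul hsW
  · filter_upwards [hV, hWpos] with i hi hWi
    have hsV : 0 < √(V i) := Real.sqrt_pos.2 hi
    have hs : 0 < √(W i) := Real.sqrt_pos.2 hWi
    rw [hWV i hi, Real.sqrt_mul hi.le,
      show m i / √(V i) + k i / √(V i) * A i = (m i + k i * A i) / √(V i) by ring,
      abs_div, abs_div, abs_of_pos hsV]
    field_simp
    ring

/-! ### The one-sample estimator -/

namespace LatentModel

variable {d a b : ℕ} {E : Type*} [MeasurableSpace E] {M : LatentModel d a b E}

/-- With a single sample, the weights cancel. -/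
lemma Standing.gradREP_one_ae_eq (hM : M.Standing) (α : ℝ) (ψ : Fin a ⊕ Fin b)
    {p : Param a b} (hp : p ∈ M.Θ ×ˢ M.Φ) :
    M.gradREP α ψ 1 p =ᵐ[M.sampleLaw 1] fun ε => Param.pderiv ψ (M.logWeight (ε 0)) p := by
  filter_upwards [hM.gradREP_ae_eq α ψ 1 hp] with ε hε
  rw [hε]
  simp [selfNormalized, softmax]

lemma Standing.hasLaw_eval (hM : M.Standing) {X : E → ℝ} (hX : AEMeasurable X M.noise) :
    HasLaw (fun ε : Fin 1 → E => X (ε 0)) (M.noise.map X) (M.sampleLaw 1) := by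
  have := hM.isProbabilityMeasure_noise
  have h := measurePreserving_eval (fun _ : Fin 1 => M.noise) 0
  exact HasLaw.comp ⟨hX, rfl⟩ ⟨h.aemeasurable, h.map_eq⟩

lemma Standing.variance_gradREP_one (hM : M.Standing) (α : ℝ) {ψ : Fin a ⊕ Fin b}
    {p : Param a b} (hp : p ∈ M.Θ ×ˢ M.Φ)
    (hY : AEMeasurable (fun ε => Param.pderiv ψ (M.logWeight ε) p) M.noise) :
    Var[M.gradREP α ψ 1 p; M.sampleLaw 1]
      = Var[fun ε => Param.pderiv ψ (M.logWeight ε) p; M.noise] := by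
  rw [variance_congr (hM.gradREP_one_ae_eq α ψ hp), (hM.hasLaw_eval hY).variance_eq,
    variance_map aemeasurable_id hY]
  rfl

/-- A constant shift leaves the variance unchanged. Taking c to be the score makes the numerator
|cov(X, Y)|; taking c = 0 gives the plain ratio. -/
lemma Standing.snr_gradREP_one_sub (hM : M.Standing) (α : ℝ) {ψ : Fin a ⊕ Fin b}
    {p : Param a b} (hp : p ∈ M.Θ ×ˢ M.Φ)
    (hY : MemLp (fun ε => Param.pderiv ψ (M.logWeight ε) p) 2 M.noise) (c : ℝ) :
    snr (fun ε => M.gradREP α ψ 1 p ε - c) (M.sampleLaw 1)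
      = |∫ ε, Param.pderiv ψ (M.logWeight ε) p ∂M.noise - c|
        / √Var[fun ε => Param.pderiv ψ (M.logWeight ε) p; M.noise] := by
  have := hM.isProbabilityMeasure_noise
  have hlaw := hM.hasLaw_eval hY.aemeasurable
  have : IsProbabilityMeasure (M.sampleLaw 1) := by unfold sampleLaw; infer_instance
  have hcongr : (fun ε => M.gradREP α ψ 1 p ε - c) =ᵐ[M.sampleLaw 1]
      fun ε => Param.pderiv ψ (M.logWeight (ε 0)) p - c := by
    filter_upwards [hM.gradREP_one_ae_eq α ψ hp] with ε hε
    rw [hε]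
  have hg : AEMeasurable (fun ε : Fin 1 → E => Param.pderiv ψ (M.logWeight (ε 0)) p)
    (M.sampleLaw 1) := hlaw.aemeasurable
  have hcomp := integral_comp_eval (μ := fun _ : Fin 1 => M.noise) (i := 0)
    (f := fun ε => Param.pderiv ψ (M.logWeight ε) p) hY.1
  have hi : Integrable (fun ε : Fin 1 → E => Param.pderiv ψ (M.logWeight (ε 0)) p)
      (M.sampleLaw 1) :=
    (measurePreserving_eval (fun _ : Fin 1 => M.noise) 0).integrable_comp_of_integrable
      (hY.integrable one_le_two)
  rw [snr, integral_congr_ae hcongr, variance_congr hcongr, variance_sub_const hg.aestronglyMeasurable,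
    ← variance_congr (hM.gradREP_one_ae_eq α ψ hp), hM.variance_gradREP_one α hp hY.aemeasurable,
    integral_sub hi (integrable_const c), sampleLaw, hcomp]
  simp

lemma Standing.snr_gradREP_one (hM : M.Standing) (α : ℝ) {ψ : Fin a ⊕ Fin b}
    {p : Param a b} (hp : p ∈ M.Θ ×ˢ M.Φ)
    (hY : MemLp (fun ε => Param.pderiv ψ (M.logWeight ε) p) 2 M.noise) :
    snr (M.gradREP α ψ 1 p) (M.sampleLaw 1)
      = |∫ ε, Param.pderiv ψ (M.logWeight ε) p ∂M.noise|
        / √Var[fun ε => Param.pderiv ψ (M.logWeight ε) p; M.noise] := by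
  simpa using hM.snr_gradREP_one_sub α hp hY 0

end LatentModel

end

/-! ### The theorem -/

theorem theorem4
    {a b : ℕ+ → ℕ} {E : ℕ+ → Type*} [∀ d, MeasurableSpace (E d)]
    (M : ∀ d : ℕ+, LatentModel (d : ℕ) (a d) (b d) (E d)) (hM : ∀ d, (M d).Standing)
    (θ : ∀ d, Fin (a d) → ℝ) (hθ : ∀ d, θ d ∈ (M d).Θ)
    (φ : ∀ d, Fin (b d) → ℝ) (hφ : ∀ d, φ d ∈ (M d).Φ)
    (ψ : ∀ d, Fin (a d) ⊕ Fin (b d))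
    (hGauss : ∀ d, (M d).IsGaussianField)
    (hDom : ∀ d, (M d).Dominated (ψ d))
    (α : ℝ) (hα : α ∈ Ico (0 : ℝ) 1)
    -- the way in which `(N, d)` tends to infinity
    (l : Filter (ℕ × ℕ+)) (hl : l ≤ atTop ×ˢ atTop)
    (hVar : ∀ᶠ p : ℕ × ℕ+ in l,
      0 < Var[(M p.2).gradREP α (ψ p.2) 1 (θ p.2, φ p.2); (M p.2).sampleLaw 1])
    (hGrowth : (fun p : ℕ × ℕ+ => Real.log p.1) =o[l]
      fun p => (M p.2).B (θ p.2) (φ p.2) (φ p.2) ^ 2)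
    (hSNR : Tendsto (fun p : ℕ × ℕ+ =>
        snr (fun ε => (M p.2).gradREP α (ψ p.2) 1 (θ p.2, φ p.2) ε
            - Param.pderiv (ψ p.2) (fun s => (M p.2).logLik s.1) (θ p.2, φ p.2))
          ((M p.2).sampleLaw 1)
        * (√(Real.log p.1) / (M p.2).B (θ p.2) (φ p.2) (φ p.2))) l (𝓝 0)) :
    -- the signal-to-noise ratios are well defined
    (∀ᶠ p : ℕ × ℕ+ in l,
      MemLp ((M p.2).gradREP α (ψ p.2) 1 (θ p.2, φ p.2)) 2 ((M p.2).sampleLaw 1) ∧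
      MemLp ((M p.2).gradREP α (ψ p.2) p.1 (θ p.2, φ p.2)) 2 ((M p.2).sampleLaw p.1) ∧
      0 < Var[(M p.2).gradREP α (ψ p.2) p.1 (θ p.2, φ p.2); (M p.2).sampleLaw p.1]) ∧
    ∃ u v : ℕ × ℕ+ → ℝ, Tendsto u l (𝓝 0) ∧ Tendsto v l (𝓝 0) ∧
      ∀ᶠ p : ℕ × ℕ+ in l,
        snr ((M p.2).gradREP α (ψ p.2) p.1 (θ p.2, φ p.2)) ((M p.2).sampleLaw p.1) =
          snr ((M p.2).gradREP α (ψ p.2) 1 (θ p.2, φ p.2)) ((M p.2).sampleLaw 1) * (1 + u p)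
            + v p := by
  obtain ⟨C, hC, hS2⟩ := exists_integral_sq_softmaxMean_le
  have hα' : 0 < 1 - α := sub_pos.2 hα.2
  have hp : ∀ d, (θ d, φ d) ∈ (M d).Θ ×ˢ (M d).Φ := fun d => ⟨hθ d, hφ d⟩
  have hgauss := fun d => (hM d).hasGaussianLaw_pderiv (hGauss d) (hDom d) (hp d)
  set X : ∀ d, E d → ℝ := fun d ε => (M d).logWeight ε (θ d, φ d) with hX
  set Y : ∀ d, E d → ℝ := fun d ε =>
    Param.pderiv (ψ d) ((M d).logWeight ε) (θ d, φ d) with hY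
  set B : ℕ+ → ℝ := fun d => (M d).B (θ d) (φ d) (φ d) with hB
  have hBX : ∀ d, B d = √Var[X d; (M d).noise] := fun d => rfl
  have hYL : ∀ d, MemLp (Y d) 2 (M d).noise := fun d => (hgauss d).1.snd.memLp_two
  -- growth of `log N`
  have hNtop : Tendsto (fun p : ℕ × ℕ+ => p.1) l atTop := tendsto_fst.mono_left hl
  have hL : Tendsto (fun p : ℕ × ℕ+ => Real.log p.1) l atTop :=
    Real.tendsto_log_atTop.comp (tendsto_natCast_atTop_atTop.comp hNtop)
  have hN : ∀ᶠ p : ℕ × ℕ+ in l, p.1 ≠ 0 := hNtop.eventually_ne_atTop 0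
  -- If B = 0, the little-o bound would force log N ≤ 0.
  have hBpos : ∀ᶠ p : ℕ × ℕ+ in l, 0 < B p.2 := by
    filter_upwards [hL.eventually_ge_atTop 1, hGrowth.bound one_pos] with p h1 h2
    refine (Real.sqrt_nonneg _).lt_of_ne fun h => ?_
    have h0 : (M p.2).B (θ p.2) (φ p.2) (φ p.2) = 0 := h.symm
    rw [h0, Real.norm_eq_abs, abs_of_nonneg (zero_le_one.trans h1)] at h2
    norm_num at h2
    linarith
  have hVarX : ∀ d, 0 < B d → 0 < Var[X d; (M d).noise] := fun d h => Real.sqrt_pos.1 h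
  -- moments of the softmax average
  set A : ℕ × ℕ+ → ℝ := fun p => ∫ g, softmaxMean ((1 - α) * B p.2) g ∂stdGauss p.1 with hA
  set D : ℕ × ℕ+ → ℝ := fun p => Var[softmaxMean ((1 - α) * B p.2); stdGauss p.1] with hD
  set Q : ℕ × ℕ+ → ℝ := fun p =>
    ∫ g, ∑ j, softmax ((1 - α) * B p.2) g j ^ 2 ∂stdGauss p.1 with hQ
  set k : ℕ+ → ℝ := fun d => cov[X d, Y d; (M d).noise] / B d with hk
  set V : ℕ+ → ℝ := fun d => Var[Y d; (M d).noise] with hV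
  -- D + A² is the second moment of the softmax average, so one estimate bounds both.
  have hAD : ∀ᶠ p : ℕ × ℕ+ in l, D p + A p ^ 2 ≤ C * (1 + Real.log p.1) := by
    filter_upwards [hN] with p hp
    have : NeZero p.1 := ⟨hp⟩
    have h := variance_eq_sub (memLp_softmaxMean p.1 ((1 - α) * B p.2))
    have h' := hS2 p.1 ((1 - α) * B p.2)
    simp only [Pi.pow_apply] at h
    simp only [hA, hD]
    linarith
  have hD0 : ∀ p, 0 ≤ D p := fun p => variance_nonneg _ _
  have hA2 : ∀ᶠ p : ℕ × ℕ+ in l, A p ^ 2 ≤ C * (1 + Real.log p.1) :=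
    hAD.mono fun p h => by linarith [hD0 p]
  have hD2 : ∀ᶠ p : ℕ × ℕ+ in l, D p ≤ C * (1 + Real.log p.1) :=
    hAD.mono fun p h => by linarith [sq_nonneg (A p)]
  -- From A = (1-α)B(1 - Q) and A² ≤ C(1 + log N) ≤ 2C log N once log N ≥ 1; the growth condition
  -- then forces Q → 1.
  have hQ1 : Tendsto Q l (𝓝 1) := by
    have hratio : Tendsto (fun p : ℕ × ℕ+ => 2 * C / (1 - α) ^ 2 * (Real.log p.1 / B p.2 ^ 2))
        l (𝓝 0) := by
      simpa using hGrowth.tendsto_div_nhds_zero.const_mul (2 * C / (1 - α) ^ 2)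
    have h2 : Tendsto (fun p => (1 - Q p) ^ 2) l (𝓝 0) := by
      refine tendsto_of_tendsto_of_tendsto_of_le_of_le' tendsto_const_nhds hratio
        (Eventually.of_forall fun _ => sq_nonneg _) ?_
      filter_upwards [hN, hBpos, hA2, hL.eventually_ge_atTop 1] with p hp hBp hAp hLp
      have : NeZero p.1 := ⟨hp⟩
      have h : A p = (1 - α) * B p.2 * (1 - Q p) := integral_softmaxMean p.1 ((1 - α) * B p.2)
      rw [div_mul_div_comm, le_div_iff₀ (by positivity)]
      calc (1 - Q p) ^ 2 * ((1 - α) ^ 2 * B p.2 ^ 2) = A p ^ 2 := by rw [h]; ring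
        _ ≤ C * (1 + Real.log p.1) := hAp
        _ ≤ 2 * C * Real.log p.1 := by nlinarith
    have h3 : Tendsto (fun p => |1 - Q p|) l (𝓝 0) := by
      simpa [Function.comp_def, Real.sqrt_sq_eq_abs] using (Real.continuous_sqrt.tendsto 0).comp h2
    simpa using ((tendsto_zero_iff_abs_tendsto_zero _).2 h3).const_sub 1
  -- the correlation between the log-weight and its derivative
  have hVpos : ∀ᶠ p : ℕ × ℕ+ in l, 0 < V p.2 := hVar.mono fun p h => by
    rwa [(hM p.2).variance_gradREP_one α (hp p.2) (hYL p.2).aemeasurable] at h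
  -- The mean 𝔼Y minus the score is -cov(X, Y), so the square of the assumed limit is cov(X, Y)²/V ·
  -- log N/B² = k² log N / V.
  have hcorr : Tendsto (fun p : ℕ × ℕ+ => k p.2 ^ 2 / V p.2 * Real.log p.1) l (𝓝 0) := by
    have h := hSNR.pow 2
    rw [zero_pow two_ne_zero] at h
    refine h.congr' ?_
    filter_upwards [hVpos] with p hVp
    rw [(hM p.2).snr_gradREP_one_sub α (hp p.2) (hYL p.2), (hgauss p.2).2, sub_add_cancel_left,
      abs_neg, mul_pow, div_pow, div_pow, sq_abs, Real.sq_sqrt (variance_nonneg _ _),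
      Real.sq_sqrt (Real.log_natCast_nonneg _)]
    simp only [hk, hV, hB]
    rw [div_pow]
    ring
  have hmom : ∀ᶠ p : ℕ × ℕ+ in l,
      MemLp ((M p.2).gradREP α (ψ p.2) p.1 (θ p.2, φ p.2)) 2 ((M p.2).sampleLaw p.1) ∧
      ∫ ε, (M p.2).gradREP α (ψ p.2) p.1 (θ p.2, φ p.2) ε ∂(M p.2).sampleLaw p.1
        = (M p.2).noise[Y p.2] + k p.2 * A p ∧
      Var[(M p.2).gradREP α (ψ p.2) p.1 (θ p.2, φ p.2); (M p.2).sampleLaw p.1]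
        = k p.2 ^ 2 * D p + (V p.2 - k p.2 ^ 2) * Q p := by
    filter_upwards [hN, hBpos] with p hp' hBp
    have : NeZero p.1 := ⟨hp'⟩
    have hae := (hM p.2).gradREP_ae_eq α (ψ p.2) p.1 (hp p.2)
    obtain ⟨h1, h2, h3⟩ := selfNormalized_moments (hgauss p.2).1 (hVarX _ hBp) (1 - α) p.1
    exact ⟨(memLp_congr_ae hae).2 h1, (integral_congr_ae hae).trans h2,
      (variance_congr hae).trans h3⟩
  obtain ⟨hpos, u, v, hu, hv, huv⟩ := exists_snr_asymptotics
    (m := fun p : ℕ × ℕ+ => (M p.2).noise[Y p.2]) (k := fun p => k p.2) (V := fun p => V p.2)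
    hVpos hL hcorr hA2 (Eventually.of_forall hD0) hD2 hQ1
  refine ⟨?_, u, v, hu, hv, ?_⟩
  · filter_upwards [hmom, hpos] with p hmp hpp
    refine ⟨?_, hmp.1, hmp.2.2 ▸ hpp⟩
    have := (hM p.2).isProbabilityMeasure_noise
    exact (memLp_congr_ae ((hM p.2).gradREP_one_ae_eq α (ψ p.2) (hp p.2))).2
      ((hYL p.2).comp_measurePreserving
        (measurePreserving_eval (fun _ : Fin 1 => (M p.2).noise) 0))
  · filter_upwards [hmom, huv] with p hmp hp'
    rw [(hM p.2).snr_gradREP_one α (hp p.2) (hYL p.2), snr, hmp.2.1, hmp.2.2]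
    exact hp'
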